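/- Let $\Bbbk$ be an algebraically closed field, let $n\ge 1$, let $q\in\Bbbk$ be a primitive $n$-th root of unity, let $n=dm$ with positive integers $d,m$, and let $\xi\in\Bbbk$. The Taft algebra is the Hopf algebra $T_q=\Bbbk\langle g,x\mid gx=q\,xg,\ g^n=1,\ x^n=0\rangle$ with $\Delta(g)=g\otimes g$ and $\Delta(x)=x\otimes 1+g\otimes x$ (so $\varepsilon(g)=1$, $\varepsilon(x)=0$, $\mathcal S(g)=g^{-1}$, $\mathcal S(x)=-g^{-1}x$). Let $\mathcal K(d,\xi)=\Bbbk\langle h,w\mid h^d=1,\ hw=q^m\,wh,\ w^n=\xi 1\rangle$; it is a left $T_q$-comodule algebra with coaction $\lambda(h)=g^m\otimes h$, $\lambda(w)=x\otimes 1+g\otimes w$. All modules are finite-dimensional. For a comodule algebra $K$ over a finite-dimensional Hopf algebra $H$, the category ${}_K\mathcal M$ of $K$-modules is a $\mathrm{Rep}(H)$-module category by $X\rhd M=X\otimes_{\Bbbk} M$, $a\cdot(v\otimes y)=a_{(-1)}\cdot v\otimes a_{(0)}\cdot y$. Its internal Hom is $\underline{\mathrm{Hom}}(M,N)=\mathrm{Hom}_K(H\otimes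 M,N)$, where $K$ acts on $H\otimes M$ by $a\cdot(r\otimes y)=a_{(-1)}r\otimes a_{(0)}\cdot y$, and $H$ acts by $(r\cdot\alpha)(r'\otimes y)=\alpha(r'r\otimes y)$; the evaluation $\underline{\mathrm{Hom}}(M,N)\rhd M\to N$ is $\alpha\otimes y\mapsto\alpha(1\otimes y)$. The category ${}^{H}_{H}\mathcal{YD}$ consists of the finite-dimensional left $H$-modules and left $H$-comodules $V$ with $(r\cdot v)_{(-1)}\otimes (r\cdot v)_{(0)}=r_{(1)}v_{(-1)}\mathcal S(r_{(3)})\otimes r_{(2)}\cdot v_{(0)}$, and it is identified with the center of $\mathrm{Rep}(H)$ through the half-braidings $\sigma_X(v\otimes y)=v_{(-1)}\cdot y\otimes v_{(0)}$. An algebra in it is an object with an associative unital algebra structure whose multiplication and unit are morphisms of modules and of comodules. Shimizu's adjoint algebra of ${}_K\mathcal M$ is the end $A=\int_{M\in{}_K\mathcal M}\underline{\mathrm{Hom}}(M,M)$ in $\mathrm{Rep}(H)$, with projections $\pi_M:A\to\underline{\mathrm{Hom}}(M,M)$, made into an algebra in ${}^{H}_{H}\mathcal{YD}$ as follows. The multiplication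 and the unit are the ones for which every $\pi_M$ is compatible with the composition $\underline{\mathrm{Hom}}(M,M)\otimes\underline{\mathrm{Hom}}(M,M)\to\underline{\mathrm{Hom}}(M,M)$ and with the coevaluation $\Bbbk\to\underline{\mathrm{Hom}}(M,M)$. The half-braiding $\sigma$ is the one for which, for all $X\in\mathrm{Rep}(H)$ and $M\in{}_K\mathcal M$, $$\mathfrak b\circ(\pi_{X\rhd M}\otimes\mathrm{id}_X)=\mathfrak a\circ(\mathrm{id}_X\otimes\pi_M)\circ\sigma_X : A\otimes X\to\underline{\mathrm{Hom}}(M,X\rhd M),$$ where $\mathfrak b:\underline{\mathrm{Hom}}(X\rhd M,X\rhd M)\otimes X\to\underline{\mathrm{Hom}}(M,X\rhd M)$ and $\mathfrak a:X\otimes\underline{\mathrm{Hom}}(M,M)\to\underline{\mathrm{Hom}}(M,X\rhd M)$ are the canonical maps, that is, $\mathfrak b(\alpha\otimes v)(r\otimes y)=\alpha(r_{(1)}\otimes (r_{(2)}\cdot v\otimes y))$ and $\mathfrak a(v\otimes\alpha)(r\otimes y)=r_{(1)}\cdot v\otimes\alpha(r_{(2)}\otimes y)$. Finally, let $\mathcal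 T(d,\xi)=\bigoplus_{i=0}^{m-1}\mathcal K(d,\xi)$, with elements $t=(t_i)_{0\le i<m}$ and componentwise product $(t_i)(s_i)=(t_is_i)$. Its $T_q$-module structure is determined by $$(g^{s}\cdot t)_i=h^{b}\,t_j\,h^{-b}\quad\text{for } s+i=mb+j,\ 0\le j<m,\qquad (x\cdot t)_i=q^i\,(w\,t_i-t_{i+1}\,w)\quad(0\le i<m),$$ where $t_m:=(g\cdot t)_{m-1}=h\,t_0\,h^{-1}$, and its coaction is $t_{(-1)}\otimes (t_{(0)})_i=g^{-i}(t_i)_{(-1)}g^i\otimes (t_i)_{(0)}$, with the coaction of $\mathcal K(d,\xi)$ on the right. This is an algebra in ${}^{T_q}_{T_q}\mathcal{YD}$. Then the adjoint algebra of the $\mathrm{Rep}(T_q)$-module category ${}_{\mathcal K(d,\xi)}\mathcal M$ exists, and it is isomorphic to $\mathcal T(d,\xi)$ as an algebra in ${}^{T_q}_{T_q}\mathcal{YD}$. -/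

import Mathlib

open scoped TensorProduct

universe u

noncomputable section

namespace TaftAdj

/-! ## Powers of a sum of two q-commuting elements -/

section QBinomial

variable {k : Type u} [Field k]

/-- Gaussian binomial coefficients at `q`. -/
def gauss (q : k) : ℕ → ℕ → k
  | _, 0 => 1
  | 0, _ + 1 => 0
  | m + 1, j + 1 => gauss q m j + q ^ (j + 1) * gauss q m (j + 1)

/-- `(q - 1)(q ^ 2 - 1) ⋯ (q ^ m - 1)`. -/
def qfac (q : k) : ℕ → k
  | 0 => 1
  | m + 1 => qfac q m * (q ^ (m + 1) - 1)

theorem gauss_zero_right (q : k) (m : ℕ) : gauss q m 0 = 1 := by cases m <;> rfl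

theorem gauss_of_lt (q : k) : ∀ (m j : ℕ), m < j → gauss q m j = 0
  | 0, 0, h => by omega
  | 0, j + 1, _ => rfl
  | m + 1, 0, h => by omega
  | m + 1, j + 1, h => by
    rw [gauss, gauss_of_lt q m j (by omega), gauss_of_lt q m (j + 1) (by omega)]; simp

theorem gauss_self (q : k) : ∀ m : ℕ, gauss q m m = 1
  | 0 => rfl
  | m + 1 => by rw [gauss, gauss_self q m, gauss_of_lt q m (m + 1) (by omega)]; simp

theorem gauss_mul_qfac (q : k) : ∀ (m j i : ℕ), m = j + i →
    gauss q m j * (qfac q j * qfac q i) = qfac q m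
  | m, 0, i, h => by
    obtain rfl : m = i := by omega
    rw [gauss_zero_right]; simp [qfac]
  | 0, j + 1, i, h => by omega
  | m + 1, j + 1, 0, h => by
    obtain rfl : m = j := by omega
    rw [gauss_self]; simp [qfac]
  | m + 1, j + 1, i + 1, h => by
    have h1 := gauss_mul_qfac q m j (i + 1) (by omega)
    have h2 := gauss_mul_qfac q m (j + 1) i (by omega)
    have h3 : m + 1 = (j + 1) + (i + 1) := by omega
    rw [gauss]
    simp only [qfac] at h1 h2 ⊢
    rw [h3, pow_add q (j + 1) (i + 1)]
    linear_combination (q ^ (j + 1) - 1) * h1 + q ^ (j + 1) * (q ^ (i + 1) - 1) * h2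

theorem qfac_ne_zero {q : k} {n : ℕ} (hq : IsPrimitiveRoot q n) :
    ∀ m, m < n → qfac q m ≠ 0
  | 0, _ => one_ne_zero
  | m + 1, h => mul_ne_zero (qfac_ne_zero hq m (by omega))
      (sub_ne_zero.2 (hq.pow_ne_one_of_pos_of_lt (by omega) h))

theorem gauss_eq_zero {q : k} {n : ℕ} (hq : IsPrimitiveRoot q n) {j : ℕ}
    (h0 : 0 < j) (h : j < n) : gauss q n j = 0 := by
  have h1 := gauss_mul_qfac q n j (n - j) (by omega)
  obtain ⟨n', rfl⟩ : ∃ n', n = n' + 1 := ⟨n - 1, by omega⟩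
  rw [qfac, hq.pow_eq_one, sub_self, mul_zero] at h1
  rcases mul_eq_zero.1 h1 with h2 | h2
  · exact h2
  · exact absurd h2 (mul_ne_zero (qfac_ne_zero hq _ h) (qfac_ne_zero hq _ (by omega)))

variable {A : Type*} [Ring A] [Algebra k A]

theorem qcomm_pow {q : k} {a b : A} (h : b * a = q • (a * b)) (j : ℕ) :
    b * a ^ j = q ^ j • (a ^ j * b) := by
  induction j with
  | zero => simp
  | succ j ih =>
    rw [pow_succ, ← mul_assoc, ih, smul_mul_assoc, mul_assoc, h, mul_smul_comm, smul_smul,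
      ← pow_succ, mul_assoc]

theorem add_pow_gauss {q : k} {a b : A} (h : b * a = q • (a * b)) (m : ℕ) :
    (a + b) ^ m = ∑ j ∈ Finset.range (m + 1), gauss q m j • (a ^ j * b ^ (m - j)) := by
  induction m with
  | zero => simp [gauss]
  | succ m ih =>
    rw [pow_succ', ih, add_mul, Finset.mul_sum, Finset.mul_sum, Finset.sum_range_succ' _ (m + 1)]
    have e1 : ∀ j ∈ Finset.range (m + 1), a * (gauss q m j • (a ^ j * b ^ (m - j)))
        = gauss q m j • (a ^ (j + 1) * b ^ (m - j)) := by
      intro j _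
      rw [mul_smul_comm, ← mul_assoc, ← pow_succ']
    have e2 : ∀ j ∈ Finset.range (m + 1), b * (gauss q m j • (a ^ j * b ^ (m - j)))
        = (q ^ j * gauss q m j) • (a ^ j * b ^ (m + 1 - j)) := by
      intro j hj
      have hj' : m + 1 - j = (m - j) + 1 := by have := Finset.mem_range.1 hj; omega
      rw [mul_smul_comm, ← mul_assoc, qcomm_pow h, smul_mul_assoc, mul_assoc, ← pow_succ',
        smul_smul, hj', mul_comm]
    rw [Finset.sum_congr rfl e1, Finset.sum_congr rfl e2,
      Finset.sum_range_succ' (fun x => (q ^ x * gauss q m x) • (a ^ x * b ^ (m + 1 - x))) m]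
    have e3 : ∑ j ∈ Finset.range m,
          (q ^ (j + 1) * gauss q m (j + 1)) • (a ^ (j + 1) * b ^ (m + 1 - (j + 1)))
        = ∑ j ∈ Finset.range (m + 1),
          (q ^ (j + 1) * gauss q m (j + 1)) • (a ^ (j + 1) * b ^ (m - j)) := by
      rw [Finset.sum_range_succ, gauss_of_lt q m (m + 1) (by omega)]
      simp
    rw [e3, ← add_assoc, ← Finset.sum_add_distrib]
    congr 1
    · refine Finset.sum_congr rfl fun j _ => ?_
      rw [gauss, add_smul]
      simp
    · simp [gauss_zero_right]

theorem qcomm_add_pow {q : k} {n : ℕ} (hn : n ≠ 0) (hq : IsPrimitiveRoot q n) {a b : A}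
    (h : b * a = q • (a * b)) : (a + b) ^ n = a ^ n + b ^ n := by
  obtain ⟨n', rfl⟩ : ∃ n', n = n' + 1 := ⟨n - 1, by omega⟩
  rw [add_pow_gauss h, Finset.sum_range_succ, Finset.sum_range_succ',
    Finset.sum_eq_zero, gauss_self, gauss_zero_right]
  · simp [add_comm]
  · intro j hj
    rw [gauss_eq_zero hq (by omega) (by have := Finset.mem_range.1 hj; omega), zero_smul]

theorem qcomm_mul_pow {q : k} {a b : A} (h : b * a = q • (a * b)) (m : ℕ) :
    (a * b) ^ m = q ^ (m * (m - 1) / 2) • (a ^ m * b ^ m) := by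
  induction m with
  | zero => simp
  | succ m ih =>
    have e : (m + 1) * (m + 1 - 1) / 2 = m + m * (m - 1) / 2 := by
      cases m with
      | zero => rfl
      | succ m =>
        simp only [Nat.add_sub_cancel]
        rw [show (m + 1 + 1) * (m + 1) = (m + 1) * m + (m + 1) * 2 by ring,
          Nat.add_mul_div_right _ _ (by norm_num)]
        omega
    rw [pow_succ', ih, mul_smul_comm, mul_assoc, ← mul_assoc b, qcomm_pow h, smul_mul_assoc,
      mul_smul_comm, smul_smul, e, pow_add, mul_comm (q ^ m), mul_assoc (a ^ m), ← mul_assoc a,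
      ← pow_succ', ← pow_succ']

theorem neg_one_pow_mul_primitive {q : k} {n : ℕ} (hn : n ≠ 0) (hq : IsPrimitiveRoot q n) :
    (-1 : k) ^ n * q ^ (n * (n - 1) / 2) = -1 := by
  rcases Nat.even_or_odd n with ⟨l, hl⟩ | ⟨l, hl⟩
  · have h1 : q ^ l = -1 := by
      have h2 : (q ^ l) ^ 2 = 1 := by rw [← pow_mul, ← hq.pow_eq_one]; congr 1; omega
      rw [sq] at h2
      rcases mul_self_eq_one_iff.1 h2 with h | h
      · exact absurd h (hq.pow_ne_one_of_pos_of_lt (by omega) (by omega))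
      · exact h
    have h3 : n * (n - 1) / 2 = l * (n - 1) := by
      rw [hl, ← two_mul, mul_assoc, Nat.mul_div_cancel_left _ (by norm_num)]
    rw [h3, pow_mul, h1, ← pow_add, Odd.neg_one_pow ⟨2 * l - 1 + l - l, by omega⟩]
  · have h3 : n * (n - 1) / 2 = n * l := by
      rw [show n - 1 = 2 * l by omega, show n * (2 * l) = 2 * (n * l) by ring,
        Nat.mul_div_cancel_left _ (by norm_num)]
    rw [h3, pow_mul, hq.pow_eq_one, one_pow, mul_one, Odd.neg_one_pow ⟨l, hl⟩]

end QBinomial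

/-! ## The algebras generated by `h, w` with `h ^ N = 1`, `h w = r w h`, `w ^ n = c` -/

section Presentation

variable (k : Type u) [Field k]

inductive QRel (N n : ℕ) (r c : k) : FreeAlgebra k (Fin 2) → FreeAlgebra k (Fin 2) → Prop
  | h_pow : QRel N n r c (FreeAlgebra.ι k 0 ^ N) 1
  | h_w : QRel N n r c (FreeAlgebra.ι k 0 * FreeAlgebra.ι k 1)
      (r • (FreeAlgebra.ι k 1 * FreeAlgebra.ι k 0))
  | w_pow : QRel N n r c (FreeAlgebra.ι k 1 ^ n) (algebraMap k _ c)

/-- The algebra `k⟨h, w | h ^ N = 1, h w = r w h, w ^ n = c⟩`. -/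
def QAlg (N n : ℕ) (r c : k) : Type u := RingQuot (QRel k N n r c)

instance (N n : ℕ) (r c : k) : Ring (QAlg k N n r c) :=
  inferInstanceAs (Ring (RingQuot (QRel k N n r c)))

instance (N n : ℕ) (r c : k) : Algebra k (QAlg k N n r c) :=
  inferInstanceAs (Algebra k (RingQuot (QRel k N n r c)))

namespace QAlg

variable {k} {N n : ℕ} {r c : k}

def mk (N n : ℕ) (r c : k) : FreeAlgebra k (Fin 2) →ₐ[k] QAlg k N n r c :=
  RingQuot.mkAlgHom k (QRel k N n r c)

/-- The generator `h`. -/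
def h : QAlg k N n r c := mk N n r c (FreeAlgebra.ι k 0)

/-- The generator `w`. -/
def w : QAlg k N n r c := mk N n r c (FreeAlgebra.ι k 1)

theorem h_pow : (h : QAlg k N n r c) ^ N = 1 := by
  have := RingQuot.mkAlgHom_rel k (QRel.h_pow (N := N) (n := n) (r := r) (c := c))
  rw [map_pow, map_one] at this
  exact this

theorem h_mul_w : (h : QAlg k N n r c) * w = r • (w * h) := by
  have := RingQuot.mkAlgHom_rel k (QRel.h_w (N := N) (n := n) (r := r) (c := c))
  rw [map_mul, map_smul, map_mul] at this
  exact this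

theorem w_pow : (w : QAlg k N n r c) ^ n = algebraMap k _ c := by
  have := RingQuot.mkAlgHom_rel k (QRel.w_pow (N := N) (n := n) (r := r) (c := c))
  rw [map_pow, AlgHom.commutes] at this
  exact this

/-- The inverse of `h` (for `N ≠ 0`). -/
def hinv : QAlg k N n r c := h ^ (N - 1)

theorem h_mul_hinv (hN : N ≠ 0) : (h : QAlg k N n r c) * hinv = 1 := by
  rw [hinv, ← pow_succ', Nat.sub_add_cancel (Nat.one_le_iff_ne_zero.2 hN), h_pow]

theorem hinv_mul_h (hN : N ≠ 0) : (hinv : QAlg k N n r c) * h = 1 := by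
  rw [hinv, ← pow_succ, Nat.sub_add_cancel (Nat.one_le_iff_ne_zero.2 hN), h_pow]

theorem hinv_pow : (hinv : QAlg k N n r c) ^ N = 1 := by
  rw [hinv, ← pow_mul, mul_comm, pow_mul, h_pow, one_pow]

theorem w_mul_hinv (hN : N ≠ 0) : (w : QAlg k N n r c) * hinv = r • (hinv * w) := by
  calc (w : QAlg k N n r c) * hinv = hinv * h * w * hinv := by rw [hinv_mul_h hN, one_mul]
    _ = hinv * (h * w) * hinv := by simp only [mul_assoc]
    _ = r • (hinv * w * (h * hinv)) := by
      rw [h_mul_w]; simp only [mul_smul_comm, smul_mul_assoc, mul_assoc]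
    _ = _ := by rw [h_mul_hinv hN, mul_one]

section Lift

variable {A : Type*} [Ring A] [Algebra k A]

/-- The algebra map determined by the images of the generators. -/
def lift (H W : A) (h1 : H ^ N = 1) (h2 : H * W = r • (W * H)) (h3 : W ^ n = algebraMap k A c) :
    QAlg k N n r c →ₐ[k] A :=
  RingQuot.liftAlgHom k ⟨FreeAlgebra.lift k ![H, W], by
    intro x y hxy
    cases hxy with
    | h_pow => simpa using h1
    | h_w => simpa using h2
    | w_pow => simpa using h3⟩

@[simp] theorem lift_h (H W : A) (h1 : H ^ N = 1) (h2 : H * W = r • (W * H))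
    (h3 : W ^ n = algebraMap k A c) : lift H W h1 h2 h3 (h : QAlg k N n r c) = H := by
  refine (RingQuot.liftAlgHom_mkAlgHom_apply k _ _ _).trans ?_
  simp

@[simp] theorem lift_w (H W : A) (h1 : H ^ N = 1) (h2 : H * W = r • (W * H))
    (h3 : W ^ n = algebraMap k A c) : lift H W h1 h2 h3 (w : QAlg k N n r c) = W := by
  refine (RingQuot.liftAlgHom_mkAlgHom_apply k _ _ _).trans ?_
  simp

theorem algHom_ext {f f' : QAlg k N n r c →ₐ[k] A} (h1 : f h = f' h) (h2 : f w = f' w) :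
    f = f' := by
  refine RingQuot.ringQuot_ext' k f f' (FreeAlgebra.hom_ext ?_)
  funext i
  fin_cases i
  · exact h1
  · exact h2

end Lift

/-- Elements of the algebra are built from `h`, `w` and scalars by sums and products. -/
theorem induction {P : QAlg k N n r c → Prop} (ha : ∀ a : k, P (algebraMap k _ a)) (hh : P h)
    (hw : P w) (hadd : ∀ a b, P a → P b → P (a + b)) (hmul : ∀ a b, P a → P b → P (a * b))
    (a : QAlg k N n r c) : P a := by
  obtain ⟨y, rfl⟩ := RingQuot.mkAlgHom_surjective k (QRel k N n r c) a
  change P (mk N n r c y)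
  induction y using FreeAlgebra.induction with
  | grade0 a => rw [AlgHom.commutes]; exact ha a
  | grade1 i =>
    fin_cases i
    · exact hh
    · exact hw
  | mul a b ha hb => rw [map_mul]; exact hmul _ _ ha hb
  | add a b ha hb => rw [map_add]; exact hadd _ _ ha hb

theorem finiteDimensional (hN : N ≠ 0) (hn : n ≠ 0) : FiniteDimensional k (QAlg k N n r c) := by
  let S : Submodule k (QAlg k N n r c) :=
    Submodule.span k (Set.range fun p : Fin n × Fin N => (w : QAlg k N n r c) ^ (p.1 : ℕ) *
      h ^ (p.2 : ℕ))
  have gen : ∀ a b : ℕ, a < n → b < N → (w : QAlg k N n r c) ^ a * h ^ b ∈ S := fun a b ha hb =>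
    Submodule.subset_span ⟨(⟨a, ha⟩, ⟨b, hb⟩), rfl⟩
  have one : (1 : QAlg k N n r c) ∈ S := by
    simpa using gen 0 0 (Nat.pos_of_ne_zero hn) (Nat.pos_of_ne_zero hN)
  have hmem : ∀ s ∈ S, h * s ∈ S := by
    intro s hs
    induction hs using Submodule.span_induction with
    | mem x hx =>
      obtain ⟨⟨a, b⟩, rfl⟩ := hx
      simp only
      have e : (h : QAlg k N n r c) * (w ^ (a : ℕ) * h ^ (b : ℕ))
          = r ^ (a : ℕ) • (w ^ (a : ℕ) * h ^ ((b : ℕ) + 1)) := by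
        rw [← mul_assoc, qcomm_pow h_mul_w, smul_mul_assoc, mul_assoc, ← pow_succ']
      rw [e]
      refine S.smul_mem _ ?_
      rcases Nat.lt_or_ge ((b : ℕ) + 1) N with hb | hb
      · exact gen _ _ a.2 hb
      · have : (b : ℕ) + 1 = N := by have := b.2; omega
        rw [this, h_pow]
        simpa using gen a 0 a.2 (Nat.pos_of_ne_zero hN)
    | zero => simp
    | add x y _ _ hx hy => rw [mul_add]; exact S.add_mem hx hy
    | smul t x _ hx => rw [mul_smul_comm]; exact S.smul_mem _ hx
  have wmem : ∀ s ∈ S, w * s ∈ S := by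
    intro s hs
    induction hs using Submodule.span_induction with
    | mem x hx =>
      obtain ⟨⟨a, b⟩, rfl⟩ := hx
      simp only
      rw [← mul_assoc, ← pow_succ']
      rcases Nat.lt_or_ge ((a : ℕ) + 1) n with ha | ha
      · exact gen _ _ ha b.2
      · have : (a : ℕ) + 1 = n := by have := a.2; omega
        rw [this, w_pow, ← Algebra.smul_def]
        refine S.smul_mem _ ?_
        simpa using gen 0 b (Nat.pos_of_ne_zero hn) b.2
    | zero => simp
    | add x y _ _ hx hy => rw [mul_add]; exact S.add_mem hx hy
    | smul t x _ hx => rw [mul_smul_comm]; exact S.smul_mem _ hx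
  have all : ∀ x : QAlg k N n r c, ∀ s ∈ S, x * s ∈ S := by
    intro x
    induction x using induction with
    | ha a => intro s hs; rw [← Algebra.smul_def]; exact S.smul_mem _ hs
    | hh => exact hmem
    | hw => exact wmem
    | hadd a b ha hb => intro s hs; rw [add_mul]; exact S.add_mem (ha s hs) (hb s hs)
    | hmul a b ha hb => intro s hs; rw [mul_assoc]; exact ha _ (hb s hs)
  have top : S = ⊤ := by
    rw [eq_top_iff]
    intro x _
    simpa using all x 1 one
  exact ⟨top ▸ Submodule.fg_span (Set.finite_range _)⟩

end QAlg

end Presentation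

/-! ## The Taft algebra -/

section Taft

variable (k : Type u) [Field k]

/-- The Taft algebra `T_q = k⟨g, x | g x = q x g, g ^ n = 1, x ^ n = 0⟩`. -/
abbrev Taft (n : ℕ) (q : k) : Type u := QAlg k n n q 0

namespace Taft

variable {k} {n : ℕ} {q : k}

/-- The grouplike generator of the Taft algebra. -/
abbrev g : Taft k n q := QAlg.h

/-- The skew primitive generator of the Taft algebra. -/
abbrev x : Taft k n q := QAlg.w

/-- The inverse of `g`. -/
abbrev ginv : Taft k n q := QAlg.hinv

theorem x_pow : (x : Taft k n q) ^ n = 0 := by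
  rw [QAlg.w_pow, map_zero]

set_option linter.unusedSectionVars false

section Structure

variable [NeZero n] [hq : Fact (IsPrimitiveRoot q n)]

/-- The coproduct `g ↦ g ⊗ g`, `x ↦ x ⊗ 1 + g ⊗ x`. -/
def comulHom : Taft k n q →ₐ[k] Taft k n q ⊗[k] Taft k n q :=
  QAlg.lift (g ⊗ₜ g) (x ⊗ₜ 1 + g ⊗ₜ x)
    (by rw [Algebra.TensorProduct.tmul_pow, QAlg.h_pow]; rfl)
    (by
      simp only [mul_add, add_mul, Algebra.TensorProduct.tmul_mul_tmul, QAlg.h_mul_w, mul_one,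
        one_mul, smul_add, TensorProduct.tmul_smul, TensorProduct.smul_tmul'])
    (by
      rw [qcomm_add_pow (NeZero.ne n) hq.out, Algebra.TensorProduct.tmul_pow,
        Algebra.TensorProduct.tmul_pow, x_pow]
      · simp
      · simp only [Algebra.TensorProduct.tmul_mul_tmul, QAlg.h_mul_w, mul_one,
          one_mul, TensorProduct.smul_tmul'])

/-- The counit `g ↦ 1`, `x ↦ 0`. -/
def counitHom : Taft k n q →ₐ[k] k :=
  QAlg.lift 1 0 (by simp) (by simp) (by simp [NeZero.ne n])

@[simp] theorem comulHom_g : comulHom (g : Taft k n q) = g ⊗ₜ g := QAlg.lift_h _ _ _ _ _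

@[simp] theorem comulHom_x : comulHom (x : Taft k n q) = x ⊗ₜ 1 + g ⊗ₜ x := QAlg.lift_w _ _ _ _ _

@[simp] theorem counitHom_g : counitHom (g : Taft k n q) = 1 := QAlg.lift_h _ _ _ _ _

@[simp] theorem counitHom_x : counitHom (x : Taft k n q) = 0 := QAlg.lift_w _ _ _ _ _

instance : Bialgebra k (Taft k n q) :=
  Bialgebra.ofAlgHom comulHom counitHom
    (by
      apply QAlg.algHom_ext
      · simp
      · simp [TensorProduct.add_tmul, TensorProduct.tmul_add, Algebra.TensorProduct.one_def,
          add_assoc])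
    (by
      apply QAlg.algHom_ext
      · simp
      · simp)
    (by
      apply QAlg.algHom_ext
      · simp
      · simp)

/-- The antipode `g ↦ g⁻¹`, `x ↦ - g⁻¹ x`, as an algebra map to the opposite algebra. -/
def antipodeHom : Taft k n q →ₐ[k] (Taft k n q)ᵐᵒᵖ :=
  QAlg.lift (MulOpposite.op ginv) (MulOpposite.op (-(ginv * x)))
    (by
      rw [← MulOpposite.op_pow, QAlg.hinv_pow, MulOpposite.op_one])
    (by
      rw [← MulOpposite.op_mul, ← MulOpposite.op_mul, ← MulOpposite.op_smul, neg_mul, mul_neg,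
        mul_assoc, QAlg.w_mul_hinv (NeZero.ne n), mul_smul_comm, smul_neg])
    (by
      rw [← MulOpposite.op_pow, neg_pow, qcomm_mul_pow (QAlg.w_mul_hinv (NeZero.ne n)), x_pow]
      simp)

/-- The antipode as a linear map. -/
def antipodeLin : Taft k n q →ₗ[k] Taft k n q :=
  (MulOpposite.opLinearEquiv k).symm.toLinearMap ∘ₗ antipodeHom.toLinearMap

theorem antipodeLin_mul (a b : Taft k n q) :
    antipodeLin (a * b) = antipodeLin b * antipodeLin a := by
  simp [antipodeLin]

@[simp] theorem antipodeLin_algebraMap (a : k) :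
    antipodeLin (algebraMap k (Taft k n q) a) = algebraMap k _ a := by
  simp only [antipodeLin, LinearMap.comp_apply, AlgHom.toLinearMap_apply, AlgHom.commutes]
  rfl

@[simp] theorem antipodeLin_one : antipodeLin (1 : Taft k n q) = 1 := by
  simpa using antipodeLin_algebraMap (n := n) (q := q) (1 : k)

@[simp] theorem antipodeLin_g : antipodeLin (g : Taft k n q) = ginv := by
  simp [antipodeLin, antipodeHom]

@[simp] theorem antipodeLin_x : antipodeLin (x : Taft k n q) = -(ginv * x) := by
  simp [antipodeLin, antipodeHom]

@[simp] theorem comul_g : Coalgebra.comul (R := k) (g : Taft k n q) = g ⊗ₜ g := comulHom_g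

@[simp] theorem comul_x : Coalgebra.comul (R := k) (x : Taft k n q) = x ⊗ₜ 1 + g ⊗ₜ x :=
  comulHom_x

@[simp] theorem counit_g : Coalgebra.counit (R := k) (g : Taft k n q) = 1 := counitHom_g

@[simp] theorem counit_x : Coalgebra.counit (R := k) (x : Taft k n q) = 0 := counitHom_x

theorem antipode_left_mul (s t : Taft k n q ⊗[k] Taft k n q) (a : k)
    (hs : LinearMap.mul' k _ (antipodeLin.rTensor _ s) = algebraMap k _ a) :
    LinearMap.mul' k _ (antipodeLin.rTensor _ (s * t)) =
      a • LinearMap.mul' k _ (antipodeLin.rTensor _ t) := by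
  induction t with
  | zero => simp
  | add t t' h h' => rw [mul_add, map_add, map_add, map_add, map_add, h, h', smul_add]
  | tmul u v =>
    have key : ∀ s : Taft k n q ⊗[k] Taft k n q,
        LinearMap.mul' k _ (antipodeLin.rTensor _ (s * u ⊗ₜ v)) =
          antipodeLin u * LinearMap.mul' k _ (antipodeLin.rTensor _ s) * v := by
      intro s
      induction s with
      | zero => simp
      | add t t' h h' => rw [add_mul, map_add, map_add, map_add, map_add, h, h', mul_add, add_mul]
      | tmul u' v' => simp [antipodeLin_mul, mul_assoc]
    rw [key, hs, ← Algebra.commutes]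
    simp [Algebra.smul_def, mul_assoc]

theorem antipode_right_mul (s t : Taft k n q ⊗[k] Taft k n q) (a : k)
    (hs : LinearMap.mul' k _ (antipodeLin.lTensor _ s) = algebraMap k _ a) :
    LinearMap.mul' k _ (antipodeLin.lTensor _ (t * s)) =
      a • LinearMap.mul' k _ (antipodeLin.lTensor _ t) := by
  induction t with
  | zero => simp
  | add t t' h h' => rw [add_mul, map_add, map_add, map_add, map_add, h, h', smul_add]
  | tmul u v =>
    have key : ∀ s : Taft k n q ⊗[k] Taft k n q,
        LinearMap.mul' k _ (antipodeLin.lTensor _ (u ⊗ₜ v * s)) =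
          u * LinearMap.mul' k _ (antipodeLin.lTensor _ s) * antipodeLin v := by
      intro s
      induction s with
      | zero => simp
      | add t t' h h' => rw [mul_add, map_add, map_add, map_add, map_add, h, h', mul_add, add_mul]
      | tmul u' v' => simp [antipodeLin_mul, mul_assoc]
    rw [key, hs, ← Algebra.commutes]
    simp [Algebra.smul_def, mul_assoc]

theorem antipode_left (a : Taft k n q) :
    LinearMap.mul' k _ (antipodeLin.rTensor _ (Coalgebra.comul (R := k) a)) =
      algebraMap k _ (Coalgebra.counit (R := k) a) := by
  induction a using QAlg.induction with
  | ha a =>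
    rw [Bialgebra.comul_algebraMap, Bialgebra.counit_algebraMap]
    simp [Algebra.TensorProduct.algebraMap_apply]
  | hh => simp [QAlg.hinv_mul_h (NeZero.ne n)]
  | hw => simp
  | hadd a b ha hb => simp only [map_add, ha, hb]
  | hmul a b ha hb =>
    rw [Bialgebra.comul_mul, Bialgebra.counit_mul, antipode_left_mul _ _ _ ha, hb, map_mul,
      Algebra.smul_def]

theorem antipode_right (a : Taft k n q) :
    LinearMap.mul' k _ (antipodeLin.lTensor _ (Coalgebra.comul (R := k) a)) =
      algebraMap k _ (Coalgebra.counit (R := k) a) := by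
  induction a using QAlg.induction with
  | ha a =>
    rw [Bialgebra.comul_algebraMap, Bialgebra.counit_algebraMap]
    simp [Algebra.TensorProduct.algebraMap_apply]
  | hh => simp [QAlg.h_mul_hinv (NeZero.ne n)]
  | hw => simp [← mul_assoc, QAlg.h_mul_hinv (NeZero.ne n)]
  | hadd a b ha hb => simp only [map_add, ha, hb]
  | hmul a b ha hb =>
    rw [Bialgebra.comul_mul, Bialgebra.counit_mul, antipode_right_mul _ _ _ hb, ha, map_mul,
      Algebra.smul_def, Algebra.commutes]

instance : HopfAlgebra k (Taft k n q) where
  antipode := antipodeLin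
  mul_antipode_rTensor_comul := LinearMap.ext antipode_left
  mul_antipode_lTensor_comul := LinearMap.ext antipode_right

end Structure

instance [NeZero n] : FiniteDimensional k (Taft k n q) :=
  QAlg.finiteDimensional (NeZero.ne n) (NeZero.ne n)

end Taft

end Taft

/-! ## Comodule algebras, representations and module categories -/

section General

variable (k : Type u) [Field k]

section ComoduleAlgebra

variable (H : Type u) [Ring H] [HopfAlgebra k H] (K : Type u) [Ring K] [Algebra k K]

/-- A left `H`-comodule algebra structure on the algebra `K`. -/
structure LeftComodAlg where
  coact : K →ₐ[k] H ⊗[k] K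
  coassoc : (Algebra.TensorProduct.assoc k k k H H K).toAlgHom.comp
      ((Algebra.TensorProduct.map (Bialgebra.comulAlgHom k H) (AlgHom.id k K)).comp coact) =
    (Algebra.TensorProduct.map (AlgHom.id k H) coact).comp coact
  counit_coact : (Algebra.TensorProduct.lid k K).toAlgHom.comp
      ((Algebra.TensorProduct.map (Bialgebra.counitAlgHom k H) (AlgHom.id k K)).comp coact) =
    AlgHom.id k K

/-- `H` as a left comodule algebra over itself. -/
def LeftComodAlg.self : LeftComodAlg k H H where
  coact := Bialgebra.comulAlgHom k H
  coassoc := by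
    ext a
    exact Coalgebra.coassoc_apply a
  counit_coact := by
    ext a
    have h := congrArg (TensorProduct.lid k H) (Coalgebra.rTensor_counit_comul (R := k) a)
    rw [TensorProduct.lid_tmul, one_smul] at h
    exact h

end ComoduleAlgebra

section Linear

variable {k}
variable {A B : Type u} [Ring A] [Algebra k A] [Ring B] [Algebra k B]
variable {V W V' W' Z : Type u} [AddCommGroup V] [Module k V] [AddCommGroup W] [Module k W]
  [AddCommGroup V'] [Module k V'] [AddCommGroup W'] [Module k W'] [AddCommGroup Z] [Module k Z]

/-- The action of `A ⊗ B` on `V ⊗ W`. -/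
def tensRho (ρ : A →ₐ[k] Module.End k V) (σ : B →ₐ[k] Module.End k W) :
    A ⊗[k] B →ₐ[k] Module.End k (V ⊗[k] W) :=
  (Module.endTensorEndAlgHom (R := k) (S := k) (A := k) (M := V) (N := W)).comp
    (Algebra.TensorProduct.map ρ σ)

@[simp] theorem tensRho_tmul (ρ : A →ₐ[k] Module.End k V) (σ : B →ₐ[k] Module.End k W)
    (a : A) (b : B) (v : V) (w : W) :
    tensRho ρ σ (a ⊗ₜ b) (v ⊗ₜ w) = ρ a v ⊗ₜ σ b w := by
  simp [tensRho, Module.endTensorEndAlgHom_apply]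

theorem tensRho_map {ρ : A →ₐ[k] Module.End k V} {σ : B →ₐ[k] Module.End k W}
    {ρ' : A →ₐ[k] Module.End k V'} {σ' : B →ₐ[k] Module.End k W'} {f : V →ₗ[k] V'}
    {f' : W →ₗ[k] W'} (hf : ∀ a v, f (ρ a v) = ρ' a (f v)) (hf' : ∀ a v, f' (σ a v) = σ' a (f' v))
    (z : A ⊗[k] B) (v : V ⊗[k] W) :
    TensorProduct.map f f' (tensRho ρ σ z v) = tensRho ρ' σ' z (TensorProduct.map f f' v) := by
  induction z with
  | zero => simp
  | add a b ha hb => simp only [map_add, LinearMap.add_apply, ha, hb]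
  | tmul a b =>
    induction v with
    | zero => simp
    | add v w hv hw => simp only [map_add, hv, hw]
    | tmul x m => simp [hf, hf']

theorem tensRho_comp (ρ : A →ₐ[k] Module.End k V) {C : Type u} [Ring C] [Algebra k C]
    (σ : C →ₐ[k] Module.End k W) (f : B →ₐ[k] C) (z : A ⊗[k] B) :
    tensRho ρ (σ.comp f) z = tensRho ρ σ (Algebra.TensorProduct.map (AlgHom.id k A) f z) := by
  induction z with
  | zero => simp
  | add z z' h h' => simp only [map_add, h, h']
  | tmul a b => apply TensorProduct.ext'; intro x y; simp

theorem tensRho_assoc (ρ : A →ₐ[k] Module.End k V) (τ : A →ₐ[k] Module.End k V')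
    (σ : B →ₐ[k] Module.End k W) (f : A →ₐ[k] A ⊗[k] A) (z : A ⊗[k] B)
    (v : (V ⊗[k] V') ⊗[k] W) :
    TensorProduct.assoc k V V' W (tensRho ((tensRho ρ τ).comp f) σ z v) =
      tensRho ρ (tensRho τ σ) (TensorProduct.assoc k A A B
        (Algebra.TensorProduct.map f (AlgHom.id k B) z)) (TensorProduct.assoc k V V' W v) := by
  have key1 : ∀ (t : A ⊗[k] A) (b : B) (x : V) (y : V') (m : W),
      TensorProduct.assoc k V V' W ((tensRho ρ τ t (x ⊗ₜ y)) ⊗ₜ σ b m) =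
      tensRho ρ (tensRho τ σ) (TensorProduct.assoc k A A B (t ⊗ₜ b)) (x ⊗ₜ (y ⊗ₜ m)) := by
    intro t b x y m
    induction t with
    | zero => simp
    | add t t' h h' =>
      simp only [map_add, LinearMap.add_apply, TensorProduct.add_tmul, h, h']
    | tmul u v => simp
  induction z with
  | zero => simp
  | add z z' h h' => simp only [map_add, LinearMap.add_apply, h, h']
  | tmul a b =>
    induction v with
    | zero => simp
    | add v w hv hw => simp only [map_add, hv, hw]
    | tmul p m =>
      induction p with
      | zero => simp
      | add v w hv hw => simp only [map_add, TensorProduct.add_tmul, hv, hw]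
      | tmul x y => simp [key1]

theorem tensRho_lid (χ : A →ₐ[k] k) (σ : B →ₐ[k] Module.End k W) (z : A ⊗[k] B)
    (v : k ⊗[k] W) :
    TensorProduct.lid k W (tensRho ((Algebra.lmul k k).comp χ) σ z v) =
      σ (TensorProduct.lid k B (Algebra.TensorProduct.map χ (AlgHom.id k B) z))
        (TensorProduct.lid k W v) := by
  induction z with
  | zero => simp
  | add z z' h h' => simp only [map_add, LinearMap.add_apply, h, h']
  | tmul a b =>
    induction v with
    | zero => simp
    | add v w hv hw => simp only [map_add, hv, hw]
    | tmul t m => simp [smul_smul, mul_comm]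

variable {H : Type u} [Ring H] [HopfAlgebra k H] {K : Type u} [Ring K] [Algebra k K]

theorem LeftComodAlg.assoc_apply (c : LeftComodAlg k H K) (a : K) :
    TensorProduct.assoc k H H K (Algebra.TensorProduct.map (Bialgebra.comulAlgHom k H)
        (AlgHom.id k K) (c.coact a)) =
      Algebra.TensorProduct.map (AlgHom.id k H) c.coact (c.coact a) :=
  congrArg (fun f => f a) c.coassoc

theorem LeftComodAlg.lid_apply (c : LeftComodAlg k H K) (a : K) :
    TensorProduct.lid k K (Algebra.TensorProduct.map (Bialgebra.counitAlgHom k H)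
        (AlgHom.id k K) (c.coact a)) = a :=
  congrArg (fun f => f a) c.counit_coact

/-- The space `Hom_K(H ⊗ M, N)`, where `K` acts on `H ⊗ M` by `a · (h ⊗ m) = a₋₁ h ⊗ a₀ · m`. -/
def homSpace (c : LeftComodAlg k H K) (σ : K →ₐ[k] Module.End k V) (τ : K →ₐ[k] Module.End k W) :
    Submodule k (H ⊗[k] V →ₗ[k] W) where
  carrier := {α | ∀ (a : K) (v : H ⊗[k] V),
    α (tensRho (Algebra.lmul k H) σ (c.coact a) v) = τ a (α v)}
  add_mem' := by
    intro f f' hf hf' a v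
    simp only [Set.mem_ofPred_eq] at hf hf'
    simp [hf, hf']
  zero_mem' := by intro a v; simp
  smul_mem' := by
    intro t f hf a v
    simp only [Set.mem_ofPred_eq] at hf
    simp [hf]

/-- The action `(h · α)(g ⊗ m) = α(g h ⊗ m)` of `H` on `Hom_K(H ⊗ M, N)`. -/
def homRho (c : LeftComodAlg k H K) (σ : K →ₐ[k] Module.End k V) (τ : K →ₐ[k] Module.End k W) :
    H →ₐ[k] Module.End k (homSpace c σ τ) :=
  AlgHom.ofLinearMap
    { toFun := fun h =>
        { toFun := fun α => ⟨α.1 ∘ₗ TensorProduct.map (LinearMap.mulRight k h) LinearMap.id,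
            fun a v => by
              rw [LinearMap.comp_apply, tensRho_map (ρ' := Algebra.lmul k H) (σ' := σ), α.2,
                LinearMap.comp_apply]
              · intro a v; simp [mul_assoc]
              · intro a v; simp⟩
          map_add' := fun _ _ => rfl
          map_smul' := fun _ _ => rfl }
      map_add' := fun h h' => by
        ext α : 2
        apply TensorProduct.ext'
        intro g m
        simp [mul_add, TensorProduct.add_tmul]
      map_smul' := fun t h => by
        ext α : 2
        apply TensorProduct.ext'
        intro g m
        simp [← TensorProduct.smul_tmul'] }
    (by
      ext α : 2
      apply TensorProduct.ext'
      intro g m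
      simp)
    (by
      intro h h'
      ext α : 2
      apply TensorProduct.ext'
      intro g m
      simp [mul_assoc])

@[simp] theorem homRho_tmul (c : LeftComodAlg k H K) (σ : K →ₐ[k] Module.End k V)
    (τ : K →ₐ[k] Module.End k W) (h g : H) (m : V) (α : homSpace c σ τ) :
    (homRho c σ τ h α).1 (g ⊗ₜ m) = α.1 ((g * h) ⊗ₜ m) := rfl

/-- The evaluation `α ⊗ m ↦ α(1 ⊗ m)`. -/
def evLin (c : LeftComodAlg k H K) (σ : K →ₐ[k] Module.End k V) (τ : K →ₐ[k] Module.End k W) :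
    homSpace c σ τ ⊗[k] V →ₗ[k] W :=
  TensorProduct.lift
    ((LinearMap.lcomp k W (TensorProduct.mk k H V 1)) ∘ₗ (homSpace c σ τ).subtype)

@[simp] theorem evLin_tmul (c : LeftComodAlg k H K) (σ : K →ₐ[k] Module.End k V)
    (τ : K →ₐ[k] Module.End k W) (α : homSpace c σ τ) (m : V) :
    evLin c σ τ (α ⊗ₜ m) = α.1 ((1 : H) ⊗ₜ m) := rfl

theorem evLin_comm (c : LeftComodAlg k H K) (σ : K →ₐ[k] Module.End k V)
    (τ : K →ₐ[k] Module.End k W) (a : K) (v : homSpace c σ τ ⊗[k] V) :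
    evLin c σ τ (tensRho (homRho c σ τ) σ (c.coact a) v) = τ a (evLin c σ τ v) := by
  induction v with
  | zero => simp
  | add v w hv hw => simp only [map_add, hv, hw]
  | tmul α m =>
    have key : ∀ z : H ⊗[k] K, evLin c σ τ (tensRho (homRho c σ τ) σ z (α ⊗ₜ m)) =
        α.1 (tensRho (Algebra.lmul k H) σ z ((1 : H) ⊗ₜ m)) := by
      intro z
      induction z with
      | zero => simp
      | add z z' h h' => simp only [map_add, LinearMap.add_apply, h, h']
      | tmul h b => simp
    rw [key, α.2, evLin_tmul]

/-- `ψ(f)(x)(h ⊗ m) = f(h · x ⊗ m)`. -/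
def psiLin (c : LeftComodAlg k H K) (ρ : H →ₐ[k] Module.End k Z) (σ : K →ₐ[k] Module.End k V)
    (τ : K →ₐ[k] Module.End k W) (f : Z ⊗[k] V →ₗ[k] W)
    (hf : ∀ a v, f (tensRho ρ σ (c.coact a) v) = τ a (f v)) : Z →ₗ[k] homSpace c σ τ where
  toFun x := ⟨f ∘ₗ TensorProduct.map (ρ.toLinearMap.flip x) LinearMap.id, fun a v => by
    rw [LinearMap.comp_apply, tensRho_map (ρ' := ρ) (σ' := σ), hf, LinearMap.comp_apply]
    · intro a v; simp
    · intro a v; simp⟩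
  map_add' x y := by
    apply Subtype.ext
    apply TensorProduct.ext'
    intro h m
    simp [TensorProduct.add_tmul]
  map_smul' t x := by
    apply Subtype.ext
    apply TensorProduct.ext'
    intro h m
    simp [← TensorProduct.smul_tmul']

@[simp] theorem psiLin_tmul (c : LeftComodAlg k H K) (ρ : H →ₐ[k] Module.End k Z)
    (σ : K →ₐ[k] Module.End k V) (τ : K →ₐ[k] Module.End k W) (f : Z ⊗[k] V →ₗ[k] W)
    (hf : ∀ a v, f (tensRho ρ σ (c.coact a) v) = τ a (f v)) (x : Z) (h : H) (m : V) :
    (psiLin c ρ σ τ f hf x).1 (h ⊗ₜ m) = f (ρ h x ⊗ₜ m) := rfl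

end Linear

/-- A finite-dimensional representation of the algebra `A`. -/
structure Repn (A : Type u) [Ring A] [Algebra k A] where
  V : Type u
  [addCommGroup : AddCommGroup V]
  [module : Module k V]
  [finite : FiniteDimensional k V]
  ρ : A →ₐ[k] Module.End k V

namespace Repn

attribute [instance] Repn.addCommGroup Repn.module Repn.finite

variable {k}

section Hom

variable {A : Type u} [Ring A] [Algebra k A]

/-- Morphisms of representations. -/
@[ext] structure Hom (M N : Repn k A) where
  lin : M.V →ₗ[k] N.V
  comm : ∀ (a : A) (v : M.V), lin (M.ρ a v) = N.ρ a (lin v)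

def Hom.id (M : Repn k A) : Hom M M := ⟨LinearMap.id, fun _ _ => rfl⟩

/-- `f.comp g` is the composite `f ∘ g`. -/
def Hom.comp {L M N : Repn k A} (f : Hom M N) (g : Hom L M) : Hom L N :=
  ⟨f.lin ∘ₗ g.lin, fun a v => by simp [g.comm, f.comm]⟩

end Hom

variable {H : Type u} [Ring H] [HopfAlgebra k H] {K : Type u} [Ring K] [Algebra k K]

/-- The unit object of `Rep(H)`. -/
def unit (H : Type u) [Ring H] [HopfAlgebra k H] : Repn k H where
  V := k
  ρ := (Algebra.lmul k k).comp (Bialgebra.counitAlgHom k H)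

/-- The object `X ▷ M = X ⊗ M` with action `a · (x ⊗ m) = a₋₁ · x ⊗ a₀ · m`. -/
def act (c : LeftComodAlg k H K) (X : Repn k H) (M : Repn k K) : Repn k K where
  V := X.V ⊗[k] M.V
  ρ := (tensRho X.ρ M.ρ).comp c.coact

/-- The tensor product of `Rep(H)`. -/
abbrev tensor (X Y : Repn k H) : Repn k H := act (LeftComodAlg.self k H) X Y

/-- `f ▷ g`. -/
def actMap (c : LeftComodAlg k H K) {X X' : Repn k H} {M M' : Repn k K} (f : Hom X X')
    (g : Hom M M') : Hom (act c X M) (act c X' M') where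
  lin := TensorProduct.map f.lin g.lin
  comm a v := tensRho_map f.comm g.comm (c.coact a) v

/-- The associativity constraint `(X ⊗ Y) ▷ M → X ▷ (Y ▷ M)`. -/
def actAssoc (c : LeftComodAlg k H K) (X Y : Repn k H) (M : Repn k K) :
    Hom (act c (tensor X Y) M) (act c X (act c Y M)) where
  lin := (TensorProduct.assoc k X.V Y.V M.V).toLinearMap
  comm a v := by
    refine (tensRho_assoc X.ρ Y.ρ M.ρ (Bialgebra.comulAlgHom k H) (c.coact a) v).trans ?_
    rw [c.assoc_apply, ← tensRho_comp]
    rfl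

/-- The unit constraint `1 ▷ M → M`. -/
def actUnit (c : LeftComodAlg k H K) (M : Repn k K) : Hom (act c (unit H) M) M where
  lin := (TensorProduct.lid k M.V).toLinearMap
  comm a v := by
    refine (tensRho_lid (Bialgebra.counitAlgHom k H) M.ρ (c.coact a) v).trans ?_
    rw [c.lid_apply]
    rfl

variable [FiniteDimensional k H]

/-- The internal Hom of the module category of `K`-modules: the space `Hom_K(H ⊗ M, N)` with
the action `(h · α)(g ⊗ m) = α(g h ⊗ m)`. -/
def ihom (c : LeftComodAlg k H K) (M N : Repn k K) : Repn k H where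
  V := homSpace c M.ρ N.ρ
  ρ := homRho c M.ρ N.ρ

/-- The evaluation `ihom M N ▷ M → N`, `α ⊗ m ↦ α(1 ⊗ m)`. -/
def ev (c : LeftComodAlg k H K) (M N : Repn k K) : Hom (act c (ihom c M N) M) N where
  lin := evLin c M.ρ N.ρ
  comm a v := evLin_comm c M.ρ N.ρ a v

/-- The bijection `Hom_K(X ▷ M, N) → Hom_H(X, ihom M N)`, `ψ(f)(x)(h ⊗ m) = f(h · x ⊗ m)`. -/
def psi (c : LeftComodAlg k H K) {X : Repn k H} {M N : Repn k K} (f : Hom (act c X M) N) :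
    Hom X (ihom c M N) where
  lin := psiLin c X.ρ M.ρ N.ρ f.lin f.comm
  comm h x := by
    apply Subtype.ext
    apply TensorProduct.ext'
    intro g m
    refine (psiLin_tmul c X.ρ M.ρ N.ρ f.lin f.comm _ g m).trans ?_
    refine Eq.trans ?_ (psiLin_tmul c X.ρ M.ρ N.ρ f.lin f.comm x (g * h) m).symm
    rw [map_mul]
    rfl

/-- The inverse bijection `Hom_H(X, ihom M N) → Hom_K(X ▷ M, N)`. -/
def phi (c : LeftComodAlg k H K) {X : Repn k H} {M N : Repn k K} (γ : Hom X (ihom c M N)) :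
    Hom (act c X M) N :=
  (ev c M N).comp (actMap c γ (Hom.id M))

/-- `ihom M N` represents the functor `Hom_K(- ▷ M, N)`. -/
theorem phi_psi (c : LeftComodAlg k H K) {X : Repn k H} {M N : Repn k K}
    (f : Hom (act c X M) N) : phi c (psi c f) = f := by
  apply Hom.ext
  apply TensorProduct.ext'
  intro x m
  refine (psiLin_tmul c X.ρ M.ρ N.ρ f.lin f.comm x 1 m).trans ?_
  rw [map_one]
  rfl

theorem psi_phi (c : LeftComodAlg k H K) {X : Repn k H} {M N : Repn k K}
    (γ : Hom X (ihom c M N)) : psi c (phi c γ) = γ := by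
  apply Hom.ext
  apply LinearMap.ext
  intro x
  apply Subtype.ext
  apply TensorProduct.ext'
  intro h m
  have e : (γ.lin (X.ρ h x)).1 ((1 : H) ⊗ₜ m) = (γ.lin x).1 (((1 : H) * h) ⊗ₜ m) :=
    congrArg (fun z : homSpace c M.ρ N.ρ => z.1 ((1 : H) ⊗ₜ m)) (γ.comm h x)
  rw [one_mul] at e
  exact e

/-- `ihom M f`. -/
def ihomMap (c : LeftComodAlg k H K) (M : Repn k K) {N N' : Repn k K} (f : Hom N N') :
    Hom (ihom c M N) (ihom c M N') :=
  psi c (f.comp (ev c M N))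

/-- `ihom f N`. -/
def ihomPre (c : LeftComodAlg k H K) {M M' : Repn k K} (f : Hom M M') (N : Repn k K) :
    Hom (ihom c M' N) (ihom c M N) :=
  psi c ((ev c M' N).comp (actMap c (Hom.id _) f))

/-- The composition `ihom M₂ M₃ ⊗ ihom M₁ M₂ → ihom M₁ M₃`. -/
def icomp (c : LeftComodAlg k H K) (M₁ M₂ M₃ : Repn k K) :
    Hom (tensor (ihom c M₂ M₃) (ihom c M₁ M₂)) (ihom c M₁ M₃) :=
  psi c ((ev c M₂ M₃).comp
    ((actMap c (Hom.id _) (ev c M₁ M₂)).comp (actAssoc c _ _ _)))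

/-- The coevaluation `1 → ihom M M`. -/
def icoev (c : LeftComodAlg k H K) (M : Repn k K) : Hom (unit H) (ihom c M M) :=
  psi c (actUnit c M)

/-- The map `𝔞⁻¹ : X ⊗ ihom M N → ihom M (X ▷ N)`. -/
def iaInv (c : LeftComodAlg k H K) (X : Repn k H) (M N : Repn k K) :
    Hom (tensor X (ihom c M N)) (ihom c M (act c X N)) :=
  psi c ((actMap c (Hom.id X) (ev c M N)).comp (actAssoc c _ _ _))

/-- The map `𝔟 : ihom (X ▷ M) N ⊗ X → ihom M N`. -/
def ib (c : LeftComodAlg k H K) (X : Repn k H) (M N : Repn k K) :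
    Hom (tensor (ihom c (act c X M) N) X) (ihom c M N) :=
  psi c ((ev c (act c X M) N).comp (actAssoc c _ _ _))

end Repn

/-! ## Algebras in the Yetter-Drinfeld category -/

section YetterDrinfeld

variable {k}
variable {H : Type u} [Ring H] [HopfAlgebra k H]

/-- For an action `ρ` of `H` on `A`, the operator
`a ⊗ b ⊗ c ↦ (h ⊗ v ↦ a h S(c) ⊗ b · v)` on `H ⊗ A`. -/
def ydOp {A : Type u} [AddCommGroup A] [Module k A] (ρ : H →ₐ[k] Module.End k A) :
    H ⊗[k] (H ⊗[k] H) →ₗ[k] Module.End k (H ⊗[k] A) :=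
  TensorProduct.lift
    { toFun := fun a => TensorProduct.lift
        { toFun := fun b =>
            { toFun := fun c => TensorProduct.map
                (LinearMap.mulLeft k a ∘ₗ LinearMap.mulRight k (HopfAlgebra.antipode k c)) (ρ b)
              map_add' := fun c c' => by
                apply TensorProduct.ext'; intro h v; simp [mul_add, TensorProduct.add_tmul]
              map_smul' := fun t c => by
                apply TensorProduct.ext'; intro h v; simp [TensorProduct.smul_tmul'] }
          map_add' := fun b b' => by
            ext c : 1
            apply TensorProduct.ext'; intro h v; simp [TensorProduct.tmul_add]
          map_smul' := fun t b => by
            ext c : 1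
            apply TensorProduct.ext'; intro h v; simp }
      map_add' := fun a a' => by
        apply TensorProduct.ext'; intro b c
        apply TensorProduct.ext'; intro h v; simp [add_mul, TensorProduct.add_tmul]
      map_smul' := fun t a => by
        apply TensorProduct.ext'; intro b c
        apply TensorProduct.ext'; intro h v; simp [TensorProduct.smul_tmul'] }

@[simp] theorem ydOp_tmul {A : Type u} [AddCommGroup A] [Module k A]
    (ρ : H →ₐ[k] Module.End k A) (a b c h : H) (v : A) :
    ydOp ρ (a ⊗ₜ (b ⊗ₜ c)) (h ⊗ₜ v) = (a * (h * HopfAlgebra.antipode k c)) ⊗ₜ ρ b v := rfl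

variable (k H)

/-- An algebra in the category of finite-dimensional left-left Yetter-Drinfeld modules over `H`:
a finite-dimensional Yetter-Drinfeld module which is an algebra whose multiplication and unit
are morphisms of `H`-modules and of `H`-comodules. -/
structure YDAlg where
  A : Type u
  [ring : Ring A]
  [algebra : Algebra k A]
  [finite : FiniteDimensional k A]
  ρ : H →ₐ[k] Module.End k A
  coact : A →ₗ[k] H ⊗[k] A
  coassoc : ∀ a, TensorProduct.assoc k H H A
      ((Coalgebra.comul (R := k) (A := H)).rTensor A (coact a)) = coact.lTensor H (coact a)
  counit_coact : ∀ a, TensorProduct.lid k A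
      ((Coalgebra.counit (R := k) (A := H)).rTensor A (coact a)) = a
  yetterDrinfeld : ∀ (h : H) (a : A), coact (ρ h a) =
    ydOp ρ ((Coalgebra.comul (R := k) (A := H)).lTensor H (Coalgebra.comul (R := k) h)) (coact a)
  act_mul : ∀ (h : H) (a b : A), ρ h (a * b) =
    LinearMap.mul' k A (tensRho ρ ρ (Coalgebra.comul (R := k) h) (a ⊗ₜ b))
  act_one : ∀ h : H, ρ h 1 = Coalgebra.counit (R := k) h • (1 : A)
  coact_mul : ∀ a b : A, coact (a * b) = coact a * coact b
  coact_one : coact 1 = 1 ⊗ₜ 1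

attribute [instance] YDAlg.ring YDAlg.algebra YDAlg.finite

variable {k H}

/-- The underlying object of `Rep(H)`. -/
def YDAlg.toRepn (A : YDAlg k H) : Repn k H where
  V := A.A
  ρ := A.ρ

/-- The half-braiding `A ⊗ X → X ⊗ A`, `a ⊗ x ↦ a₋₁ · x ⊗ a₀`. -/
def YDAlg.braid (A : YDAlg k H) (X : Repn k H) : A.A ⊗[k] X.V →ₗ[k] X.V ⊗[k] A.A :=
  TensorProduct.lift
    { toFun := fun a =>
        { toFun := fun x => (X.ρ.toLinearMap.flip x).rTensor A.A (A.coact a)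
          map_add' := fun x y => by simp [LinearMap.rTensor_add]
          map_smul' := fun t x => by simp [LinearMap.rTensor_smul] }
      map_add' := fun a b => by ext x; simp
      map_smul' := fun t a => by ext x; simp }

/-- Isomorphisms of algebras in the Yetter-Drinfeld category. -/
structure YDAlg.Iso (A B : YDAlg k H) where
  equiv : A.A ≃ₐ[k] B.A
  map_act : ∀ (h : H) (a : A.A), equiv (A.ρ h a) = B.ρ h (equiv a)
  map_coact : ∀ a : A.A,
    B.coact (equiv a) = equiv.toLinearMap.lTensor H (A.coact a)

end YetterDrinfeld

/-! ## The adjoint algebra of a module category -/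

section AdjointAlgebra

variable {k}
variable {H : Type u} [Ring H] [HopfAlgebra k H] [FiniteDimensional k H]
variable {K : Type u} [Ring K] [Algebra k K]

open Repn

/-- Dinatural transformations `E → ihom M M`, `M` a finite-dimensional `K`-module. -/
def IsDinatural (c : LeftComodAlg k H K) {E : Repn k H}
    (ξ : ∀ M : Repn k K, Hom E (ihom c M M)) : Prop :=
  ∀ (M N : Repn k K) (f : Hom M N),
    (ihomMap c M f).comp (ξ M) = (ihomPre c f N).comp (ξ N)

/-- Shimizu's adjoint algebra of the `Rep(H)`-module category of finite-dimensional `K`-modules: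
the end of `ihom M M` over all `M`, with its canonical half-braiding (expressed by the
corresponding Yetter-Drinfeld coaction) and its canonical algebra structure. -/
structure AdjointAlgebra (c : LeftComodAlg k H K) where
  toYDAlg : YDAlg k H
  /-- The projections of the end. -/
  π : ∀ M : Repn k K, Hom toYDAlg.toRepn (ihom c M M)
  dinatural : IsDinatural c π
  universal : ∀ (E : Repn k H) (ξ : ∀ M : Repn k K, Hom E (ihom c M M)), IsDinatural c ξ →
    ∃! f : Hom E toYDAlg.toRepn, ∀ M, (π M).comp f = ξ M
  braid_compat : ∀ (X : Repn k H) (M : Repn k K) (a : toYDAlg.A) (x : X.V),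
    (ib c X M (act c X M)).lin ((π (act c X M)).lin a ⊗ₜ x) =
      (iaInv c X M M).lin ((π M).lin.lTensor X.V (toYDAlg.braid X (a ⊗ₜ x)))
  mul_compat : ∀ (M : Repn k K) (a b : toYDAlg.A),
    (π M).lin (a * b : toYDAlg.A) = (icomp c M M M).lin ((π M).lin a ⊗ₜ (π M).lin b)
  one_compat : ∀ M : Repn k K, (π M).lin (1 : toYDAlg.A) = (icoev c M).lin (1 : k)

end AdjointAlgebra

end General

/-! ## Multiplicativity of the Yetter-Drinfeld operator -/

section YDLemmas

variable {k : Type u} [Field k] {H : Type u} [Ring H] [HopfAlgebra k H]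
variable {A : Type u} [Ring A] [Algebra k A] (ρ : H →ₐ[k] Module.End k A)

theorem ydOp_mul (z z' : H ⊗[k] (H ⊗[k] H)) : ydOp ρ (z * z') = ydOp ρ z * ydOp ρ z' := by
  induction z with
  | zero => simp
  | add u v hu hv => simp only [add_mul, map_add, hu, hv]
  | tmul a y =>
    induction y with
    | zero => simp
    | add u v hu hv => simp only [add_mul, TensorProduct.tmul_add, map_add, hu, hv]
    | tmul b c =>
      induction z' with
      | zero => simp
      | add u v hu hv => simp only [mul_add, map_add, hu, hv]
      | tmul a' y' =>
        induction y' with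
        | zero => simp
        | add u v hu hv => simp only [mul_add, TensorProduct.tmul_add, map_add, hu, hv]
        | tmul b' c' =>
          apply TensorProduct.ext'
          intro h v
          simp [HopfAlgebra.antipode_mul_antidistrib, mul_assoc]

theorem yd_mul (coact : A →ₗ[k] H ⊗[k] A) (h h' : H)
    (e : ∀ a, coact (ρ h a) = ydOp ρ ((Coalgebra.comul (R := k) (A := H)).lTensor H
      (Coalgebra.comul (R := k) h)) (coact a))
    (e' : ∀ a, coact (ρ h' a) = ydOp ρ ((Coalgebra.comul (R := k) (A := H)).lTensor H
      (Coalgebra.comul (R := k) h')) (coact a)) (a : A) :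
    coact (ρ (h * h') a) = ydOp ρ ((Coalgebra.comul (R := k) (A := H)).lTensor H
      (Coalgebra.comul (R := k) (h * h'))) (coact a) := by
  have key : (Coalgebra.comul (R := k) (A := H)).lTensor H (Coalgebra.comul (R := k) (h * h')) =
      (Coalgebra.comul (R := k) (A := H)).lTensor H (Coalgebra.comul (R := k) h) *
      (Coalgebra.comul (R := k) (A := H)).lTensor H (Coalgebra.comul (R := k) h') := by
    rw [Bialgebra.comul_mul]
    exact map_mul (Algebra.TensorProduct.map (AlgHom.id k H) (Bialgebra.comulAlgHom k H)) _ _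
  rw [key, ydOp_mul, map_mul, Module.End.mul_apply, Module.End.mul_apply, e, e']

theorem yd_algebraMap (coact : A →ₗ[k] H ⊗[k] A) (t : k) (a : A) :
    coact (ρ (algebraMap k H t) a) = ydOp ρ ((Coalgebra.comul (R := k) (A := H)).lTensor H
      (Coalgebra.comul (R := k) (algebraMap k H t))) (coact a) := by
  have e : ydOp ρ (1 ⊗ₜ (1 ⊗ₜ 1)) = LinearMap.id := by
    apply TensorProduct.ext'
    intro h v
    simp
  rw [Algebra.algebraMap_eq_smul_one, map_smul, map_smul, Bialgebra.comul_one, map_smul,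
    Algebra.TensorProduct.one_def, LinearMap.lTensor_tmul, Bialgebra.comul_one,
    Algebra.TensorProduct.one_def, map_smul, e]
  simp

theorem actMul_mul (h h' : H)
    (e : ∀ a b, ρ h (a * b) =
      LinearMap.mul' k A (tensRho ρ ρ (Coalgebra.comul (R := k) h) (a ⊗ₜ b)))
    (e' : ∀ a b, ρ h' (a * b) =
      LinearMap.mul' k A (tensRho ρ ρ (Coalgebra.comul (R := k) h') (a ⊗ₜ b))) (a b : A) :
    ρ (h * h') (a * b) =
      LinearMap.mul' k A (tensRho ρ ρ (Coalgebra.comul (R := k) (h * h')) (a ⊗ₜ b)) := by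
  have key : ∀ v : A ⊗[k] A, ρ h (LinearMap.mul' k A v) =
      LinearMap.mul' k A (tensRho ρ ρ (Coalgebra.comul (R := k) h) v) := by
    intro v
    induction v with
    | zero => simp
    | add v w hv hw => simp only [map_add, hv, hw]
    | tmul a b => rw [LinearMap.mul'_apply, e]
  rw [Bialgebra.comul_mul, map_mul ρ, map_mul (tensRho ρ ρ), Module.End.mul_apply,
    Module.End.mul_apply, e', key]

end YDLemmas

/-! ## The comodule algebras `K(d, ξ)` -/

/-- The algebra `K(d, ξ) = k⟨h, w | h ^ d = 1, h w = q ^ m w h, w ^ n = ξ⟩`, where `n = d m`. -/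
abbrev KAlg (k : Type u) [Field k] (d m n : ℕ) (q ξ : k) : Type u := QAlg k d n (q ^ m) ξ

namespace KAlg

variable {k : Type u} [Field k] {d m n : ℕ} {q : k} {ξ : k}

section

variable [NeZero n] [hq : Fact (IsPrimitiveRoot q n)]

/-- The coaction `h ↦ g ^ m ⊗ h`, `w ↦ x ⊗ 1 + g ⊗ w`. -/
def coactHom (hdm : d * m = n) : KAlg k d m n q ξ →ₐ[k] Taft k n q ⊗[k] KAlg k d m n q ξ :=
  QAlg.lift ((Taft.g ^ m) ⊗ₜ QAlg.h) (Taft.x ⊗ₜ 1 + Taft.g ⊗ₜ QAlg.w)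
    (by
      rw [Algebra.TensorProduct.tmul_pow, ← pow_mul, mul_comm m, hdm, QAlg.h_pow, QAlg.h_pow]
      rfl)
    (by
      have e : (Taft.g : Taft k n q) ^ m * Taft.x = q ^ m • (Taft.x * Taft.g ^ m) := by
        have h := QAlg.h_mul_w (k := k) (N := n) (n := n) (r := q) (c := 0)
        clear hdm
        induction m with
        | zero => simp
        | succ m ih =>
          rw [pow_succ, mul_assoc, h, mul_smul_comm, ← mul_assoc, ih, smul_mul_assoc, smul_smul,
            mul_assoc, ← pow_succ, pow_succ' q]
      simp only [mul_add, add_mul, Algebra.TensorProduct.tmul_mul_tmul, e, QAlg.h_mul_w, mul_one,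
        one_mul, smul_add, TensorProduct.tmul_smul, TensorProduct.smul_tmul', ← pow_succ,
        ← pow_succ'])
    (by
      rw [qcomm_add_pow (NeZero.ne n) hq.out, Algebra.TensorProduct.tmul_pow,
        Algebra.TensorProduct.tmul_pow, Taft.x_pow, QAlg.h_pow, QAlg.w_pow]
      · rw [TensorProduct.zero_tmul, zero_add, Algebra.TensorProduct.algebraMap_apply',
          Algebra.algebraMap_eq_smul_one]
      · simp only [Algebra.TensorProduct.tmul_mul_tmul, QAlg.h_mul_w, mul_one,
          one_mul, TensorProduct.smul_tmul'])

@[simp] theorem coactHom_h (hdm : d * m = n) :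
    coactHom hdm (QAlg.h : KAlg k d m n q ξ) = (Taft.g ^ m) ⊗ₜ QAlg.h := QAlg.lift_h _ _ _ _ _

@[simp] theorem coactHom_w (hdm : d * m = n) :
    coactHom hdm (QAlg.w : KAlg k d m n q ξ) = Taft.x ⊗ₜ 1 + Taft.g ⊗ₜ QAlg.w :=
  QAlg.lift_w _ _ _ _ _

/-- `K(d, ξ)` as a left `T_q`-comodule algebra. -/
def comodAlg (ξ : k) (hdm : d * m = n) :
    LeftComodAlg k (Taft k n q) (KAlg k d m n q ξ) where
  coact := coactHom hdm
  coassoc := by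
    apply QAlg.algHom_ext
    · simp
    · simp [TensorProduct.add_tmul, TensorProduct.tmul_add, Algebra.TensorProduct.one_def,
        add_assoc]
  counit_coact := by
    apply QAlg.algHom_ext
    · simp
    · simp

end

end KAlg

/-! ## The algebras `T(d, ξ)` -/

namespace TAlg

variable {k : Type u} [Field k] {d m n : ℕ} {q : k} {ξ : k}

/-- For `s = m a + r`, the action of `g ^ s`: `(g ^ s · t)_i = h ^ b t_j h ^ (-b)`, where
`s + i = m b + j` with `0 ≤ j < m`. -/
def gOp (d m n : ℕ) (q ξ : k) (s : ℕ) : Module.End k (Fin m → KAlg k d m n q ξ) where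
  toFun t i := QAlg.h ^ ((s + i) / m) * t ⟨(s + i) % m, Nat.mod_lt _ i.pos⟩ *
    QAlg.hinv ^ ((s + i) / m)
  map_add' t t' := by funext i; simp [mul_add, add_mul]
  map_smul' a t := by funext i; simp

/-- The action of `x`: `(x · t)_i = q ^ i (w t_i - t_{i + 1} w)`, where `t_{i + 1} = (g · t)_i`
(so that `t_m = h t_0 h⁻¹`). -/
def xOp (d m n : ℕ) (q ξ : k) : Module.End k (Fin m → KAlg k d m n q ξ) where
  toFun t i := q ^ (i : ℕ) • (QAlg.w * t i - gOp d m n q ξ 1 t i * QAlg.w)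
  map_add' t t' := by
    funext i
    simp only [Pi.add_apply, map_add, mul_add, add_mul, ← smul_add]
    congr 1
    abel
  map_smul' a t := by
    funext i
    simp only [Pi.smul_apply, map_smul, mul_smul_comm, smul_mul_assoc, ← smul_sub, RingHom.id_apply]
    rw [smul_comm]

/-- The left multiplication `t_i ↦ q ^ i w t_i`. -/
def lOp (d m n : ℕ) (q ξ : k) : Module.End k (Fin m → KAlg k d m n q ξ) where
  toFun t i := q ^ (i : ℕ) • (QAlg.w * t i)
  map_add' t t' := by funext i; simp [mul_add]
  map_smul' a t := by funext i; simp [smul_comm a]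

/-- The right multiplication `t_i ↦ q ^ i t_i w`. -/
def pOp (d m n : ℕ) (q ξ : k) : Module.End k (Fin m → KAlg k d m n q ξ) where
  toFun t i := q ^ (i : ℕ) • (t i * QAlg.w)
  map_add' t t' := by funext i; simp [add_mul]
  map_smul' a t := by funext i; simp [smul_comm a]

theorem gOp_apply (s : ℕ) (t : Fin m → KAlg k d m n q ξ) (i : Fin m) :
    gOp d m n q ξ s t i = QAlg.h ^ ((s + i) / m) * t ⟨(s + i) % m, Nat.mod_lt _ i.pos⟩ *
      QAlg.hinv ^ ((s + i) / m) := rfl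

theorem gOp_mul (s s' : ℕ) : gOp d m n q ξ s * gOp d m n q ξ s' = gOp d m n q ξ (s + s') := by
  apply LinearMap.ext
  intro t
  funext i
  have e : s + s' + i = s' + (s + i) % m + m * ((s + i) / m) := by
    have := Nat.mod_add_div (s + i) m
    omega
  have e1 : (s + s' + i) / m = (s + i) / m + (s' + (s + i) % m) / m := by
    rw [e, Nat.add_mul_div_left _ _ i.pos, add_comm]
  have e2 : (s + s' + i) % m = (s' + (s + i) % m) % m := by
    rw [e, Nat.add_mul_mod_self_left]
  rw [Module.End.mul_apply, gOp_apply, gOp_apply, gOp_apply]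
  simp only [e1, e2]
  rw [pow_add, add_comm ((s + (i : ℕ)) / m), pow_add]
  simp only [mul_assoc]

theorem gOp_zero : gOp d m n q ξ 0 = 1 := by
  apply LinearMap.ext
  intro t
  funext i
  rw [gOp_apply]
  simp [Nat.div_eq_of_lt i.2, Nat.mod_eq_of_lt i.2]

theorem gOp_pow (s : ℕ) : gOp d m n q ξ 1 ^ s = gOp d m n q ξ s := by
  induction s with
  | zero => rw [pow_zero, gOp_zero]
  | succ s ih => rw [pow_succ, ih, gOp_mul]

theorem gOp_period (hdm : d * m = n) : gOp d m n q ξ n = 1 := by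
  apply LinearMap.ext
  intro t
  funext i
  have e : n + i = i + m * d := by rw [← hdm, mul_comm, add_comm]
  have e1 : (n + i) / m = d := by
    rw [e, Nat.add_mul_div_left _ _ i.pos, Nat.div_eq_of_lt i.2, zero_add]
  have e2 : (n + i) % m = i := by rw [e, Nat.add_mul_mod_self_left, Nat.mod_eq_of_lt i.2]
  rw [gOp_apply]
  simp only [e1, e2, QAlg.h_pow, QAlg.hinv_pow]
  simp

theorem hinv_pow_mul (hd : d ≠ 0) (e : ℕ) :
    (QAlg.hinv : KAlg k d m n q ξ) ^ e * QAlg.h ^ e = 1 := by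
  have h : Commute (QAlg.hinv : KAlg k d m n q ξ) QAlg.h :=
    (QAlg.hinv_mul_h hd).trans (QAlg.h_mul_hinv hd).symm
  rw [← h.mul_pow, QAlg.hinv_mul_h hd, one_pow]

theorem h_pow_mul_w (e : ℕ) :
    (QAlg.h : KAlg k d m n q ξ) ^ e * QAlg.w = q ^ (m * e) • (QAlg.w * QAlg.h ^ e) := by
  induction e with
  | zero => simp
  | succ e ih =>
    rw [pow_succ, mul_assoc, QAlg.h_mul_w, mul_smul_comm, ← mul_assoc, ih, smul_mul_assoc,
      smul_smul, mul_assoc, ← pow_add, mul_add, mul_one, add_comm m]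

theorem w_mul_hinv_pow (hd : d ≠ 0) (e : ℕ) :
    (QAlg.w : KAlg k d m n q ξ) * QAlg.hinv ^ e = q ^ (m * e) • (QAlg.hinv ^ e * QAlg.w) := by
  rw [qcomm_pow (QAlg.w_mul_hinv hd), ← pow_mul]

theorem index_eq (i : Fin m) : (1 + (i : ℕ)) % m + m * ((1 + i) / m) = 1 + i :=
  Nat.mod_add_div _ _

theorem gOp_lOp : gOp d m n q ξ 1 * lOp d m n q ξ = q • (lOp d m n q ξ * gOp d m n q ξ 1) := by
  apply LinearMap.ext
  intro t
  funext i
  simp only [Module.End.mul_apply, LinearMap.smul_apply, Pi.smul_apply]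
  rw [gOp_apply]
  change _ = q • q ^ (i : ℕ) • (QAlg.w * gOp d m n q ξ 1 t i)
  rw [gOp_apply]
  change _ * (q ^ ((1 + (i : ℕ)) % m) • (QAlg.w * _)) * _ = _
  rw [mul_smul_comm, smul_mul_assoc, ← mul_assoc, h_pow_mul_w, smul_mul_assoc, smul_mul_assoc,
    smul_smul, smul_smul, ← pow_add, index_eq, pow_add, pow_one]
  simp only [mul_assoc]

theorem gOp_pOp (hd : d ≠ 0) :
    gOp d m n q ξ 1 * pOp d m n q ξ = q • (pOp d m n q ξ * gOp d m n q ξ 1) := by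
  apply LinearMap.ext
  intro t
  funext i
  simp only [Module.End.mul_apply, LinearMap.smul_apply, Pi.smul_apply]
  rw [gOp_apply]
  change _ = q • q ^ (i : ℕ) • (gOp d m n q ξ 1 t i * QAlg.w)
  rw [gOp_apply]
  change _ * (q ^ ((1 + (i : ℕ)) % m) • (_ * QAlg.w)) * _ = _
  rw [mul_smul_comm, smul_mul_assoc, mul_assoc, mul_assoc, w_mul_hinv_pow hd, mul_smul_comm,
    mul_smul_comm, smul_smul, smul_smul, ← pow_add, index_eq, pow_add, pow_one]
  simp only [mul_assoc]

theorem lOp_pOp : lOp d m n q ξ * pOp d m n q ξ = pOp d m n q ξ * lOp d m n q ξ := by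
  apply LinearMap.ext
  intro t
  funext i
  change q ^ (i : ℕ) • (QAlg.w * (q ^ (i : ℕ) • (t i * QAlg.w))) =
    q ^ (i : ℕ) • ((q ^ (i : ℕ) • (QAlg.w * t i)) * QAlg.w)
  rw [mul_smul_comm, smul_mul_assoc, mul_assoc]

theorem lOp_pow (s : ℕ) (t : Fin m → KAlg k d m n q ξ) (i : Fin m) :
    (lOp d m n q ξ ^ s) t i = (q ^ (i : ℕ)) ^ s • (QAlg.w ^ s * t i) := by
  induction s generalizing t with
  | zero => simp
  | succ s ih =>
    rw [pow_succ, Module.End.mul_apply, ih]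
    change _ • (_ * (q ^ (i : ℕ) • (QAlg.w * t i))) = _
    rw [mul_smul_comm, smul_smul, ← pow_succ, ← mul_assoc, ← pow_succ]

theorem pOp_pow (s : ℕ) (t : Fin m → KAlg k d m n q ξ) (i : Fin m) :
    (pOp d m n q ξ ^ s) t i = (q ^ (i : ℕ)) ^ s • (t i * QAlg.w ^ s) := by
  induction s generalizing t with
  | zero => simp
  | succ s ih =>
    rw [pow_succ, Module.End.mul_apply, ih]
    change _ • ((q ^ (i : ℕ) • (t i * QAlg.w)) * _) = _
    rw [smul_mul_assoc, smul_smul, ← pow_succ, mul_assoc, ← pow_succ']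

theorem xOp_eq : xOp d m n q ξ =
    lOp d m n q ξ + (-1 : k) • (pOp d m n q ξ * gOp d m n q ξ 1) := by
  apply LinearMap.ext
  intro t
  funext i
  change q ^ (i : ℕ) • (QAlg.w * t i - gOp d m n q ξ 1 t i * QAlg.w) =
    q ^ (i : ℕ) • (QAlg.w * t i) + (-1 : k) • (q ^ (i : ℕ) • (gOp d m n q ξ 1 t i * QAlg.w))
  rw [smul_sub, sub_eq_add_neg, neg_one_smul]

theorem gOp_xOp (hd : d ≠ 0) :
    gOp d m n q ξ 1 * xOp d m n q ξ = q • (xOp d m n q ξ * gOp d m n q ξ 1) := by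
  rw [xOp_eq, mul_add, gOp_lOp, mul_smul_comm, ← mul_assoc, gOp_pOp hd, add_mul, smul_add,
    smul_mul_assoc, smul_mul_assoc, smul_comm]

theorem ne_zero_left [NeZero n] (hdm : d * m = n) : d ≠ 0 := by
  rintro rfl
  exact NeZero.ne n (by rw [← hdm, zero_mul])

section Structure

variable [NeZero n] [hq : Fact (IsPrimitiveRoot q n)]

theorem xOp_pow (hdm : d * m = n) : xOp d m n q ξ ^ n = 0 := by
  have hd : d ≠ 0 := ne_zero_left hdm
  have h1 : ((-1 : k) • (pOp d m n q ξ * gOp d m n q ξ 1)) * lOp d m n q ξ =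
      q • (lOp d m n q ξ * ((-1 : k) • (pOp d m n q ξ * gOp d m n q ξ 1))) := by
    rw [smul_mul_assoc, mul_assoc, gOp_lOp, mul_smul_comm, ← mul_assoc, ← lOp_pOp, mul_smul_comm,
      mul_assoc, smul_comm]
  have hqi : ∀ i : ℕ, (q ^ i) ^ n = 1 := fun i => by
    rw [← pow_mul, mul_comm, pow_mul, hq.out.pow_eq_one, one_pow]
  have hL : lOp d m n q ξ ^ n = ξ • (1 : Module.End k (Fin m → KAlg k d m n q ξ)) := by
    apply LinearMap.ext
    intro t
    funext i
    rw [lOp_pow, hqi, QAlg.w_pow, one_smul, ← Algebra.smul_def]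
    rfl
  have hP : pOp d m n q ξ ^ n = ξ • (1 : Module.End k (Fin m → KAlg k d m n q ξ)) := by
    apply LinearMap.ext
    intro t
    funext i
    rw [pOp_pow, hqi, QAlg.w_pow, one_smul, ← Algebra.commutes, ← Algebra.smul_def]
    rfl
  have h2 := neg_one_pow_mul_primitive (NeZero.ne n) hq.out
  rw [xOp_eq, qcomm_add_pow (NeZero.ne n) hq.out h1, smul_pow,
    qcomm_mul_pow (q := q) (gOp_pOp (m := m) (n := n) (q := q) (ξ := ξ) hd), hL, hP,
    gOp_pow, gOp_period hdm, mul_one, smul_smul, h2, smul_smul, ← add_smul]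
  simp

/-- The action of `T_q` on `T(d, ξ)`. -/
def rho (ξ : k) (hdm : d * m = n) : Taft k n q →ₐ[k] Module.End k (Fin m → KAlg k d m n q ξ) :=
  QAlg.lift (gOp d m n q ξ 1) (xOp d m n q ξ) (by rw [gOp_pow, gOp_period hdm])
    (gOp_xOp (ne_zero_left hdm)) (by rw [xOp_pow hdm, map_zero])

@[simp] theorem rho_g (hdm : d * m = n) : rho ξ hdm (Taft.g : Taft k n q) = gOp d m n q ξ 1 :=
  QAlg.lift_h _ _ _ _ _

@[simp] theorem rho_x (hdm : d * m = n) : rho ξ hdm (Taft.x : Taft k n q) = xOp d m n q ξ :=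
  QAlg.lift_w _ _ _ _ _

theorem rho_g_pow (hdm : d * m = n) (s : ℕ) :
    rho ξ hdm ((Taft.g : Taft k n q) ^ s) = gOp d m n q ξ s := by
  rw [map_pow, rho_g, gOp_pow]

end Structure

end TAlg

set_option linter.unusedSectionVars false
namespace Taft

variable {k : Type u} [Field k] {n : ℕ} {q : k} [NeZero n]

theorem commute_g_ginv : Commute (g : Taft k n q) ginv :=
  (QAlg.h_mul_hinv (NeZero.ne n)).trans (QAlg.hinv_mul_h (NeZero.ne n)).symm

theorem g_pow_mul_ginv_pow (i : ℕ) : (g : Taft k n q) ^ i * ginv ^ i = 1 := by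
  rw [← commute_g_ginv.mul_pow, QAlg.h_mul_hinv (NeZero.ne n), one_pow]

theorem ginv_pow_mul_g_pow (i : ℕ) : (ginv : Taft k n q) ^ i * g ^ i = 1 := by
  rw [← commute_g_ginv.symm.mul_pow, QAlg.hinv_mul_h (NeZero.ne n), one_pow]

/-- The conjugation `a ↦ g ^ (-i) a g ^ i`. -/
def conj (i : ℕ) : Taft k n q →ₐ[k] Taft k n q :=
  AlgHom.ofLinearMap (LinearMap.mulLeft k (ginv ^ i) ∘ₗ LinearMap.mulRight k (g ^ i))
    (by simp [ginv_pow_mul_g_pow])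
    (by
      intro a b
      simp only [LinearMap.comp_apply, LinearMap.mulLeft_apply, LinearMap.mulRight_apply]
      calc ginv ^ i * (a * b * g ^ i) = ginv ^ i * (a * 1 * b * g ^ i) := by rw [mul_one]
        _ = _ := by rw [← g_pow_mul_ginv_pow i]; simp only [mul_assoc])

theorem conj_apply (i : ℕ) (a : Taft k n q) : conj i a = ginv ^ i * (a * g ^ i) := rfl

@[simp] theorem conj_g (i : ℕ) : conj i (g : Taft k n q) = g := by
  rw [conj_apply, ← pow_succ', pow_succ, ← mul_assoc, ginv_pow_mul_g_pow, one_mul]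

theorem g_pow_mul_x (i : ℕ) : (g : Taft k n q) ^ i * x = q ^ i • (x * g ^ i) := by
  induction i with
  | zero => simp
  | succ m ih =>
    rw [pow_succ, mul_assoc, QAlg.h_mul_w, mul_smul_comm, ← mul_assoc, ih, smul_mul_assoc,
      smul_smul, mul_assoc, ← pow_succ, pow_succ' q]

theorem smul_conj_x (i : ℕ) : q ^ i • conj i (x : Taft k n q) = x := by
  rw [conj_apply, ← mul_smul_comm, ← g_pow_mul_x, ← mul_assoc, ginv_pow_mul_g_pow, one_mul]

variable [hq : Fact (IsPrimitiveRoot q n)]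

theorem conj_x (i : ℕ) : conj i (x : Taft k n q) = (q ^ i)⁻¹ • x := by
  conv_rhs => rw [← smul_conj_x i]
  rw [smul_smul, inv_mul_cancel₀ (pow_ne_zero i (hq.out.ne_zero (NeZero.ne n))), one_smul]

end Taft

namespace TAlg

section PiTensor

variable {k : Type u} [Field k] {m : ℕ} {U A : Type u} [AddCommGroup U] [Module k U]
  [AddCommGroup A] [Module k A]

theorem pi_tensor_ext {z z' : U ⊗[k] (Fin m → A)}
    (h : ∀ i : Fin m, (LinearMap.proj (R := k) (φ := fun _ : Fin m => A) i).lTensor U z =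
      (LinearMap.proj (R := k) (φ := fun _ : Fin m => A) i).lTensor U z') : z = z' := by
  have e : ∀ z : U ⊗[k] (Fin m → A), TensorProduct.piRight k k U (fun _ : Fin m => A) z =
      fun i => (LinearMap.proj (R := k) (φ := fun _ : Fin m => A) i).lTensor U z := by
    intro z
    induction z with
    | zero => simp; rfl
    | add a b ha hb => rw [map_add, ha, hb]; funext i; simp
    | tmul a b => funext i; simp
  apply (TensorProduct.piRight k k U (fun _ : Fin m => A)).injective
  rw [e, e]
  funext i
  exact h i

end PiTensor

variable {k : Type u} [Field k] {d m n : ℕ} {q : k} {ξ : k}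
variable [NeZero n] [hq : Fact (IsPrimitiveRoot q n)]

/-- The map `a ↦ g ^ (-i) a₋₁ g ^ i ⊗ a₀` on `K(d, ξ)`. -/
def coactAt (ξ : k) (hdm : d * m = n) (i : ℕ) :
    KAlg k d m n q ξ →ₐ[k] Taft k n q ⊗[k] KAlg k d m n q ξ :=
  (Algebra.TensorProduct.map (Taft.conj i) (AlgHom.id k _)).comp (KAlg.coactHom hdm)

theorem coactAt_h (hdm : d * m = n) (i : ℕ) :
    coactAt ξ hdm i (QAlg.h : KAlg k d m n q ξ) = (Taft.g ^ m) ⊗ₜ QAlg.h := by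
  simp [coactAt]

theorem coactAt_w (hdm : d * m = n) (i : ℕ) :
    coactAt ξ hdm i (QAlg.w : KAlg k d m n q ξ) =
      ((q ^ i)⁻¹ • Taft.x) ⊗ₜ 1 + Taft.g ⊗ₜ QAlg.w := by
  simp [coactAt, Taft.conj_x]

/-- The coaction on `T(d, ξ)`: `t₋₁ ⊗ (t₀)_i = g ^ (-i) (t_i)₋₁ g ^ i ⊗ (t_i)₀`. -/
def coact (ξ : k) (hdm : d * m = n) : (Fin m → KAlg k d m n q ξ) →ₐ[k]
    Taft k n q ⊗[k] (Fin m → KAlg k d m n q ξ) :=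
  (Algebra.TensorProduct.piRight k k (Taft k n q)
      (fun _ : Fin m => KAlg k d m n q ξ)).symm.toAlgHom.comp
    (AlgHom.pi fun i => (coactAt ξ hdm i).comp (Pi.evalAlgHom k _ i))

/-- The `i`-th projection `T_q ⊗ T(d, ξ) → T_q ⊗ K(d, ξ)`. -/
def projAt (ξ : k) (d m n : ℕ) (q : k) (i : Fin m) : Taft k n q ⊗[k] (Fin m → KAlg k d m n q ξ) →ₐ[k]
    Taft k n q ⊗[k] KAlg k d m n q ξ :=
  Algebra.TensorProduct.map (AlgHom.id k _) (Pi.evalAlgHom k _ i)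

theorem projAt_coact (hdm : d * m = n) (t : Fin m → KAlg k d m n q ξ) (i : Fin m) :
    projAt ξ d m n q i (coact ξ hdm t) = coactAt ξ hdm i (t i) := by
  have e : ∀ z, projAt ξ d m n q i z = Algebra.TensorProduct.piRight k k (Taft k n q)
      (fun _ : Fin m => KAlg k d m n q ξ) z i := by
    intro z
    induction z with
    | zero => simp
    | add a b ha hb => rw [map_add, ha, hb, map_add]; rfl
    | tmul a b => simp [projAt]
  rw [e]
  simp [coact]

theorem projAt_ext {z z' : Taft k n q ⊗[k] (Fin m → KAlg k d m n q ξ)}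
    (h : ∀ i, projAt ξ d m n q i z = projAt ξ d m n q i z') : z = z' :=
  pi_tensor_ext h

theorem coactAt_coassoc (hdm : d * m = n) (i : ℕ) (a : KAlg k d m n q ξ) :
    TensorProduct.assoc k _ _ _ (Algebra.TensorProduct.map (Bialgebra.comulAlgHom k (Taft k n q))
      (AlgHom.id k _) (coactAt ξ hdm i a)) =
    Algebra.TensorProduct.map (AlgHom.id k _) (coactAt ξ hdm i) (coactAt ξ hdm i a) := by
  have e : (Algebra.TensorProduct.assoc k k k (Taft k n q) (Taft k n q)
      (KAlg k d m n q ξ)).toAlgHom.comp ((Algebra.TensorProduct.map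
      (Bialgebra.comulAlgHom k (Taft k n q)) (AlgHom.id k (KAlg k d m n q ξ))).comp
        (coactAt ξ hdm i)) =
      (Algebra.TensorProduct.map (AlgHom.id k (Taft k n q)) (coactAt ξ hdm i)).comp
        (coactAt ξ hdm i) := by
    apply QAlg.algHom_ext
    · simp [coactAt_h]
    · simp [coactAt_w, TensorProduct.add_tmul, TensorProduct.tmul_add,
        Algebra.TensorProduct.one_def, add_assoc, ← TensorProduct.smul_tmul',
        TensorProduct.tmul_smul]
  exact congrArg (fun f => f a) e

theorem coactAt_counit (hdm : d * m = n) (i : ℕ) (a : KAlg k d m n q ξ) :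
    TensorProduct.lid k _ (Algebra.TensorProduct.map (Bialgebra.counitAlgHom k (Taft k n q))
      (AlgHom.id k _) (coactAt ξ hdm i a)) = a := by
  have e : (Algebra.TensorProduct.lid k (KAlg k d m n q ξ)).toAlgHom.comp
      ((Algebra.TensorProduct.map (Bialgebra.counitAlgHom k (Taft k n q)) (AlgHom.id k _)).comp
      (coactAt ξ hdm i)) = AlgHom.id k _ := by
    apply QAlg.algHom_ext
    · simp [coactAt_h]
    · simp [coactAt_w]
  exact congrArg (fun f => f a) e

theorem coact_coassoc (hdm : d * m = n) (t : Fin m → KAlg k d m n q ξ) :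
    TensorProduct.assoc k _ _ _ ((Coalgebra.comul (R := k) (A := Taft k n q)).rTensor _
      (coact ξ hdm t)) = (coact ξ hdm).toLinearMap.lTensor _ (coact ξ hdm t) := by
  apply (TensorProduct.assoc k (Taft k n q) (Taft k n q)
    (Fin m → KAlg k d m n q ξ)).symm.injective
  apply pi_tensor_ext
  intro i
  apply (TensorProduct.assoc k (Taft k n q) (Taft k n q) (KAlg k d m n q ξ)).injective
  have h1 : ∀ z : Taft k n q ⊗[k] (Taft k n q ⊗[k] (Fin m → KAlg k d m n q ξ)),
      TensorProduct.assoc k _ _ _ ((LinearMap.proj (R := k)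
        (φ := fun _ : Fin m => KAlg k d m n q ξ) i).lTensor (Taft k n q ⊗[k] Taft k n q)
        ((TensorProduct.assoc k _ _ _).symm z)) =
      (projAt ξ d m n q i).toLinearMap.lTensor _ z := by
    intro z
    induction z with
    | zero => simp
    | add a b ha hb => simp only [map_add, ha, hb]
    | tmul a y =>
      induction y with
      | zero => simp
      | add u v hu hv => simp only [TensorProduct.tmul_add, map_add, hu, hv]
      | tmul b c => simp [projAt]
  have h2 : ∀ z : Taft k n q ⊗[k] (Fin m → KAlg k d m n q ξ),
      (projAt ξ d m n q i).toLinearMap.lTensor _ (TensorProduct.assoc k _ _ _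
        ((Coalgebra.comul (R := k) (A := Taft k n q)).rTensor _ z)) =
      TensorProduct.assoc k _ _ _ (Algebra.TensorProduct.map
        (Bialgebra.comulAlgHom k (Taft k n q)) (AlgHom.id k _) (projAt ξ d m n q i z)) := by
    intro z
    induction z with
    | zero => simp
    | add a b ha hb => simp only [map_add, ha, hb]
    | tmul a b =>
      have : ∀ y : Taft k n q ⊗[k] Taft k n q, (projAt ξ d m n q i).toLinearMap.lTensor _
          (TensorProduct.assoc k _ _ _ (y ⊗ₜ b)) = TensorProduct.assoc k _ _ _ (y ⊗ₜ b i) := by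
        intro y
        induction y with
        | zero => simp
        | add u v hu hv => simp only [TensorProduct.add_tmul, map_add, hu, hv]
        | tmul u v => simp [projAt]
      rw [LinearMap.rTensor_tmul, this]
      simp [projAt]
  have h3 : ∀ z : Taft k n q ⊗[k] (Fin m → KAlg k d m n q ξ),
      (projAt ξ d m n q i).toLinearMap.lTensor _ ((coact ξ hdm).toLinearMap.lTensor _ z) =
      Algebra.TensorProduct.map (AlgHom.id k _) (coactAt ξ hdm i) (projAt ξ d m n q i z) := by
    intro z
    induction z with
    | zero => simp
    | add a b ha hb => simp only [map_add, ha, hb]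
    | tmul a b =>
      rw [LinearMap.lTensor_tmul, LinearMap.lTensor_tmul, AlgHom.toLinearMap_apply,
        AlgHom.toLinearMap_apply, projAt_coact]
      simp [projAt]
  rw [h1, h1, h2, h3, projAt_coact, coactAt_coassoc]

theorem coact_counit (hdm : d * m = n) (t : Fin m → KAlg k d m n q ξ) :
    TensorProduct.lid k _ ((Coalgebra.counit (R := k) (A := Taft k n q)).rTensor _
      (coact ξ hdm t)) = t := by
  funext i
  have h : ∀ z : Taft k n q ⊗[k] (Fin m → KAlg k d m n q ξ),
      TensorProduct.lid k _ ((Coalgebra.counit (R := k) (A := Taft k n q)).rTensor _ z) i =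
      TensorProduct.lid k _ (Algebra.TensorProduct.map (Bialgebra.counitAlgHom k (Taft k n q))
      (AlgHom.id k _) (projAt ξ d m n q i z)) := by
    intro z
    induction z with
    | zero => simp
    | add a b ha hb => simp only [map_add, Pi.add_apply, ha, hb]
    | tmul a b => simp [projAt]
  rw [h, projAt_coact, coactAt_counit]

theorem gOp_mul_apply (hd : d ≠ 0) (t t' : Fin m → KAlg k d m n q ξ) :
    gOp d m n q ξ 1 (t * t') = gOp d m n q ξ 1 t * gOp d m n q ξ 1 t' := by
  funext i
  rw [Pi.mul_apply, gOp_apply, gOp_apply, gOp_apply, Pi.mul_apply]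
  generalize t ⟨_, _⟩ = a, t' ⟨_, _⟩ = b, (1 + (i : ℕ)) / m = e
  calc QAlg.h ^ e * (a * b) * QAlg.hinv ^ e = QAlg.h ^ e * a * 1 * b * QAlg.hinv ^ e := by
        simp only [mul_assoc, one_mul]
    _ = _ := by rw [← hinv_pow_mul hd e]; simp only [mul_assoc]

/-- Compatibility of the coaction with the action of `g`. -/
theorem projAt_coact_gOp (hdm : d * m = n) (t : Fin m → KAlg k d m n q ξ) (i : Fin m) :
    projAt ξ d m n q i (coact ξ hdm (gOp d m n q ξ 1 t)) =
      projAt ξ d m n q i (TensorProduct.map (LinearMap.mulLeft k Taft.g ∘ₗ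
        LinearMap.mulRight k Taft.ginv) (gOp d m n q ξ 1) (coact ξ hdm t)) := by
  have hd := ne_zero_left hdm
  obtain ⟨e, he⟩ : ∃ e, e = (1 + (i : ℕ)) / m := ⟨_, rfl⟩
  obtain ⟨l, hl⟩ : ∃ l : Fin m, l = ⟨(1 + i) % m, Nat.mod_lt _ i.pos⟩ := ⟨_, rfl⟩
  have hle : (l : ℕ) + m * e = 1 + i := by rw [hl, he]; exact index_eq i
  have hg : ∀ t : Fin m → KAlg k d m n q ξ,
      gOp d m n q ξ 1 t i = QAlg.h ^ e * t l * QAlg.hinv ^ e := by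
    intro t; rw [gOp_apply, hl, he]
  have h1 : ∀ z : Taft k n q ⊗[k] (Fin m → KAlg k d m n q ξ),
      projAt ξ d m n q i (TensorProduct.map (LinearMap.mulLeft k Taft.g ∘ₗ
        LinearMap.mulRight k Taft.ginv) (gOp d m n q ξ 1) z) =
      TensorProduct.map (LinearMap.mulLeft k Taft.g ∘ₗ LinearMap.mulRight k Taft.ginv)
        (LinearMap.mulLeft k (QAlg.h ^ e) ∘ₗ LinearMap.mulRight k (QAlg.hinv ^ e))
        (projAt ξ d m n q l z) := by
    intro z
    induction z with
    | zero => simp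
    | add a b ha hb => simp only [map_add, ha, hb]
    | tmul a b => simp [projAt, hg, mul_assoc]
  have hinv : coactAt ξ hdm i (QAlg.hinv : KAlg k d m n q ξ) = (Taft.ginv ^ m) ⊗ₜ QAlg.hinv := by
    have h2 : coactAt ξ hdm i (QAlg.hinv : KAlg k d m n q ξ) * coactAt ξ hdm i QAlg.h = 1 := by
      rw [← map_mul, QAlg.hinv_mul_h hd, map_one]
    have h3 : coactAt ξ hdm i (QAlg.h : KAlg k d m n q ξ) *
        ((Taft.ginv ^ m) ⊗ₜ QAlg.hinv) = 1 := by
      rw [coactAt_h, Algebra.TensorProduct.tmul_mul_tmul, Taft.g_pow_mul_ginv_pow,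
        QAlg.h_mul_hinv hd, Algebra.TensorProduct.one_def]
    exact left_inv_eq_right_inv h2 h3
  have hc : (Taft.ginv : Taft k n q) ^ (i : ℕ) * Taft.g ^ (m * e) = Taft.g * Taft.ginv ^ (l : ℕ) := by
    have hcomm : Commute ((Taft.ginv : Taft k n q) ^ (i : ℕ)) (Taft.g ^ (m * e)) :=
      (Taft.commute_g_ginv.symm.pow_left _).pow_right _
    calc _ = Taft.g ^ (m * e) * Taft.ginv ^ (i : ℕ) := hcomm
      _ = Taft.ginv ^ (l : ℕ) * Taft.g ^ (l : ℕ) * Taft.g ^ (m * e) * Taft.ginv ^ (i : ℕ) := by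
        rw [Taft.ginv_pow_mul_g_pow, one_mul]
      _ = Taft.ginv ^ (l : ℕ) * Taft.g ^ ((l : ℕ) + m * e) * Taft.ginv ^ (i : ℕ) := by
        rw [pow_add]; simp only [mul_assoc]
      _ = Taft.ginv ^ (l : ℕ) * Taft.g * (Taft.g ^ (i : ℕ) * Taft.ginv ^ (i : ℕ)) := by
        rw [hle, pow_add, pow_one]; simp only [mul_assoc]
      _ = Taft.ginv ^ (l : ℕ) * Taft.g := by rw [Taft.g_pow_mul_ginv_pow, mul_one]
      _ = _ := (Taft.commute_g_ginv.symm.pow_left _)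
  have hc' : (Taft.ginv : Taft k n q) ^ (m * e) * Taft.g ^ (i : ℕ) = Taft.g ^ (l : ℕ) * Taft.ginv := by
    have e1 : (Taft.ginv : Taft k n q) ^ (m * e) * Taft.g ^ (i : ℕ) *
        (Taft.ginv ^ (i : ℕ) * Taft.g ^ (m * e)) = 1 := by
      rw [mul_assoc, ← mul_assoc (Taft.g ^ (i : ℕ)), Taft.g_pow_mul_ginv_pow, one_mul,
        Taft.ginv_pow_mul_g_pow]
    rw [hc] at e1
    have e2 : (Taft.g : Taft k n q) * Taft.ginv ^ (l : ℕ) * (Taft.g ^ (l : ℕ) * Taft.ginv) = 1 := by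
      rw [mul_assoc, ← mul_assoc (Taft.ginv ^ (l : ℕ)), Taft.ginv_pow_mul_g_pow, one_mul,
        QAlg.h_mul_hinv (NeZero.ne n)]
    exact left_inv_eq_right_inv e1 e2
  rw [h1, projAt_coact, projAt_coact, hg, map_mul, map_mul, map_pow, map_pow, hinv, coactAt_h,
    Algebra.TensorProduct.tmul_pow, Algebra.TensorProduct.tmul_pow, ← pow_mul, ← pow_mul]
  have h4 : ∀ z : Taft k n q ⊗[k] KAlg k d m n q ξ,
      (Taft.g ^ (m * e)) ⊗ₜ (QAlg.h ^ e) * Algebra.TensorProduct.map (Taft.conj i)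
        (AlgHom.id k _) z * (Taft.ginv ^ (m * e)) ⊗ₜ (QAlg.hinv ^ e) =
      TensorProduct.map (LinearMap.mulLeft k Taft.g ∘ₗ LinearMap.mulRight k Taft.ginv)
        (LinearMap.mulLeft k (QAlg.h ^ e) ∘ₗ LinearMap.mulRight k (QAlg.hinv ^ e))
        (Algebra.TensorProduct.map (Taft.conj l) (AlgHom.id k _) z) := by
    intro z
    induction z with
    | zero => simp
    | add a b ha hb => simp only [map_add, mul_add, add_mul, ha, hb]
    | tmul a b =>
      simp only [Algebra.TensorProduct.map_tmul, Algebra.TensorProduct.tmul_mul_tmul,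
        TensorProduct.map_tmul, AlgHom.id_apply, LinearMap.comp_apply, LinearMap.mulLeft_apply,
        LinearMap.mulRight_apply, Taft.conj_apply]
      congr 1
      · have hcomm : Commute ((Taft.g : Taft k n q) ^ (m * e)) (Taft.ginv ^ (i : ℕ)) :=
          (Taft.commute_g_ginv.pow_left _).pow_right _
        have hcomm' : Commute ((Taft.g : Taft k n q) ^ (i : ℕ)) (Taft.ginv ^ (m * e)) :=
          (Taft.commute_g_ginv.pow_left _).pow_right _
        calc _ = (Taft.g ^ (m * e) * Taft.ginv ^ (i : ℕ)) * a *
              (Taft.g ^ (i : ℕ) * Taft.ginv ^ (m * e)) := by simp only [mul_assoc]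
          _ = _ := by rw [hcomm.eq, hcomm'.eq, hc, hc']; simp only [mul_assoc]
      · simp only [mul_assoc]
  exact h4 _

theorem antipode_g : HopfAlgebra.antipode k (Taft.g : Taft k n q) = Taft.ginv :=
  Taft.antipodeLin_g

theorem antipode_x : HopfAlgebra.antipode k (Taft.x : Taft k n q) = -(Taft.ginv * Taft.x) :=
  Taft.antipodeLin_x

theorem yd_x_aux {U A : Type u} [Ring U] [Algebra k U] [Ring A] [Algebra k A] {c : k} (hc : c ≠ 0)
    (g g' x a : U) (hg : g' * g = 1) (w s G : A) :
    c • (((c⁻¹ • x) ⊗ₜ[k] (1 : A) + g ⊗ₜ[k] w) * (a ⊗ₜ[k] s) -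
      ((g * (a * g')) ⊗ₜ[k] G) * ((c⁻¹ • x) ⊗ₜ[k] (1 : A) + g ⊗ₜ[k] w)) =
    (x * a) ⊗ₜ[k] s + ((g * a) ⊗ₜ[k] (c • (w * s - G * w)) + (g * (a * -(g' * x))) ⊗ₜ[k] G) := by
  have e : g * (a * g') * g = g * a := by rw [mul_assoc, mul_assoc, hg, mul_one]
  have e2 : g * (a * g') * (c⁻¹ • x) = c⁻¹ • (g * (a * (g' * x))) := by
    rw [mul_smul_comm]; simp only [mul_assoc]
  have e3 : g * (a * -(g' * x)) = -(g * (a * (g' * x))) := by rw [mul_neg, mul_neg]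
  rw [add_mul, mul_add, Algebra.TensorProduct.tmul_mul_tmul, Algebra.TensorProduct.tmul_mul_tmul,
    Algebra.TensorProduct.tmul_mul_tmul, Algebra.TensorProduct.tmul_mul_tmul, e, e2, e3, one_mul,
    mul_one, smul_mul_assoc, TensorProduct.tmul_smul, TensorProduct.tmul_sub, smul_sub, smul_sub,
    smul_add, smul_add, ← TensorProduct.smul_tmul', ← TensorProduct.smul_tmul', smul_smul,
    smul_smul, mul_inv_cancel₀ hc, one_smul, one_smul, TensorProduct.neg_tmul]
  abel

/-- Compatibility of the coaction with the action of `x`. -/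
theorem yd_x (hdm : d * m = n) (i : Fin m) (z : Taft k n q ⊗[k] (Fin m → KAlg k d m n q ξ)) :
    q ^ (i : ℕ) • ((((q ^ (i : ℕ))⁻¹ • Taft.x) ⊗ₜ[k] 1 + Taft.g ⊗ₜ[k] QAlg.w) *
        projAt ξ d m n q i z - projAt ξ d m n q i (TensorProduct.map (LinearMap.mulLeft k Taft.g ∘ₗ
          LinearMap.mulRight k Taft.ginv) (gOp d m n q ξ 1) z) *
        (((q ^ (i : ℕ))⁻¹ • Taft.x) ⊗ₜ[k] 1 + Taft.g ⊗ₜ[k] QAlg.w)) =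
    projAt ξ d m n q i (ydOp (rho ξ hdm) (Taft.x ⊗ₜ[k] (1 ⊗ₜ[k] 1) +
      (Taft.g ⊗ₜ[k] (Taft.x ⊗ₜ[k] 1) + Taft.g ⊗ₜ[k] (Taft.g ⊗ₜ[k] Taft.x))) z) := by
  generalize hW : (((q ^ (i : ℕ))⁻¹ • (Taft.x : Taft k n q)) ⊗ₜ[k] (1 : KAlg k d m n q ξ) +
    Taft.g ⊗ₜ[k] QAlg.w) = W
  have key : q ^ (i : ℕ) • (LinearMap.mulLeft k W ∘ₗ (projAt ξ d m n q i).toLinearMap -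
      LinearMap.mulRight k W ∘ₗ (projAt ξ d m n q i).toLinearMap ∘ₗ
      TensorProduct.map (LinearMap.mulLeft k Taft.g ∘ₗ
          LinearMap.mulRight k Taft.ginv) (gOp d m n q ξ 1)) =
      (projAt ξ d m n q i).toLinearMap ∘ₗ (ydOp (rho ξ hdm) (Taft.x ⊗ₜ[k] (1 ⊗ₜ[k] 1) +
      (Taft.g ⊗ₜ[k] (Taft.x ⊗ₜ[k] 1) + Taft.g ⊗ₜ[k] (Taft.g ⊗ₜ[k] Taft.x)))) := by
    apply TensorProduct.ext'
    intro a b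
    have h := yd_x_aux (c := q ^ (i : ℕ)) (pow_ne_zero _ (hq.out.ne_zero (NeZero.ne n)))
      (Taft.g : Taft k n q) Taft.ginv Taft.x a (QAlg.hinv_mul_h (NeZero.ne n))
      (QAlg.w : KAlg k d m n q ξ) (b i) (gOp d m n q ξ 1 b i)
    rw [hW] at h
    refine h.trans ?_
    rw [LinearMap.comp_apply, map_add, map_add, LinearMap.add_apply, LinearMap.add_apply,
      ydOp_tmul, ydOp_tmul, ydOp_tmul, antipode_x, rho_g, rho_x, HopfAlgebra.antipode_one, map_one (rho ξ hdm),
      mul_one, map_add, map_add]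
    rfl
  exact congrArg (fun f => f z) key

theorem coact_yd (hdm : d * m = n) (h : Taft k n q) (t : Fin m → KAlg k d m n q ξ) :
    coact ξ hdm (rho ξ hdm h t) = ydOp (rho ξ hdm) ((Coalgebra.comul (R := k)
      (A := Taft k n q)).lTensor _ (Coalgebra.comul (R := k) h)) (coact ξ hdm t) := by
  induction h using QAlg.induction generalizing t with
  | ha a => exact yd_algebraMap (rho ξ hdm) (coact ξ hdm).toLinearMap a t
  | hadd a b ha hb => simp only [map_add, LinearMap.add_apply, ha, hb]
  | hmul a b ha hb => exact yd_mul (rho ξ hdm) (coact ξ hdm).toLinearMap a b ha hb t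
  | hh =>
    rw [Taft.comul_g, LinearMap.lTensor_tmul, Taft.comul_g, rho_g]
    apply projAt_ext
    intro i
    rw [projAt_coact_gOp]
    congr 1
    simp only [ydOp, TensorProduct.lift.tmul, LinearMap.coe_mk, AddHom.coe_mk, rho_g, antipode_g]
  | hw =>
    rw [Taft.comul_x, rho_x, map_add, LinearMap.lTensor_tmul, LinearMap.lTensor_tmul,
      Taft.comul_x, Bialgebra.comul_one, Algebra.TensorProduct.one_def, TensorProduct.tmul_add]
    apply projAt_ext
    intro i
    rw [projAt_coact]
    change coactAt ξ hdm i (q ^ (i : ℕ) • (QAlg.w * t i - gOp d m n q ξ 1 t i * QAlg.w)) = _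
    rw [map_smul, map_sub, map_mul, map_mul, ← projAt_coact, ← projAt_coact, projAt_coact_gOp,
      coactAt_w]
    exact yd_x hdm i (coact ξ hdm t)

theorem act_mul (hdm : d * m = n) (h : Taft k n q) (t t' : Fin m → KAlg k d m n q ξ) :
    rho ξ hdm h (t * t') = LinearMap.mul' k _ (tensRho (rho ξ hdm) (rho ξ hdm)
      (Coalgebra.comul (R := k) h) (t ⊗ₜ t')) := by
  induction h using QAlg.induction generalizing t t' with
  | ha a =>
    rw [Algebra.algebraMap_eq_smul_one, map_smul, map_smul, Bialgebra.comul_one, map_smul]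
    simp
  | hadd a b ha hb => simp only [map_add, LinearMap.add_apply, ha, hb]
  | hmul a b ha hb => exact actMul_mul (rho ξ hdm) a b ha hb t t'
  | hh =>
    rw [Taft.comul_g, tensRho_tmul, LinearMap.mul'_apply, rho_g, gOp_mul_apply (ne_zero_left hdm)]
  | hw =>
    rw [Taft.comul_x, map_add, LinearMap.add_apply, tensRho_tmul, tensRho_tmul, map_add,
      LinearMap.mul'_apply, LinearMap.mul'_apply, rho_x, rho_g, map_one, Module.End.one_apply]
    funext i
    change q ^ (i : ℕ) • (QAlg.w * (t i * t' i) - gOp d m n q ξ 1 (t * t') i * QAlg.w) =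
      q ^ (i : ℕ) • (QAlg.w * t i - gOp d m n q ξ 1 t i * QAlg.w) * t' i +
      gOp d m n q ξ 1 t i * q ^ (i : ℕ) • (QAlg.w * t' i - gOp d m n q ξ 1 t' i * QAlg.w)
    rw [gOp_mul_apply (ne_zero_left hdm), Pi.mul_apply, smul_mul_assoc, mul_smul_comm, ← smul_add]
    congr 1
    noncomm_ring

theorem act_one (hdm : d * m = n) (h : Taft k n q) :
    rho ξ hdm h (1 : Fin m → KAlg k d m n q ξ) = Coalgebra.counit (R := k) h • 1 := by
  have hg : gOp d m n q ξ 1 1 = 1 := by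
    funext i
    have hcomm : Commute (QAlg.h : KAlg k d m n q ξ) QAlg.hinv :=
      (QAlg.h_mul_hinv (ne_zero_left hdm)).trans (QAlg.hinv_mul_h (ne_zero_left hdm)).symm
    rw [gOp_apply, Pi.one_apply, mul_one, ← hcomm.mul_pow, QAlg.h_mul_hinv (ne_zero_left hdm),
      one_pow, Pi.one_apply]
  induction h using QAlg.induction with
  | ha a =>
    rw [Bialgebra.counit_algebraMap, Algebra.algebraMap_eq_smul_one, map_smul,
      map_one (TAlg.rho ξ hdm)]
    rfl
  | hadd a b ha hb => simp only [map_add, LinearMap.add_apply, ha, hb, add_smul]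
  | hmul a b ha hb =>
    rw [map_mul, Module.End.mul_apply, hb, map_smul, ha, Bialgebra.counit_mul, smul_smul, mul_comm]
  | hh => rw [rho_g, hg, Taft.counit_g, one_smul]
  | hw =>
    rw [rho_x, Taft.counit_x, zero_smul]
    funext i
    change q ^ (i : ℕ) • (QAlg.w * 1 - gOp d m n q ξ 1 1 i * QAlg.w) = 0
    rw [hg]
    simp

end TAlg

/-- The algebra `T(d, ξ) = ⨁_{0 ≤ i < m} K(d, ξ)` in the Yetter-Drinfeld category of `T_q`, with
componentwise product. -/
def TAlg {k : Type u} [Field k] {d m n : ℕ} {q : k} [NeZero n]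
    [hq : Fact (IsPrimitiveRoot q n)] (ξ : k) (hdm : d * m = n) : YDAlg k (Taft k n q) where
  A := Fin m → KAlg k d m n q ξ
  finite := by
    have : FiniteDimensional k (KAlg k d m n q ξ) :=
      QAlg.finiteDimensional (TAlg.ne_zero_left hdm) (NeZero.ne n)
    infer_instance
  ρ := TAlg.rho ξ hdm
  coact := (TAlg.coact ξ hdm).toLinearMap
  coassoc := TAlg.coact_coassoc hdm
  counit_coact := TAlg.coact_counit hdm
  yetterDrinfeld := TAlg.coact_yd hdm
  act_mul := TAlg.act_mul hdm
  act_one := TAlg.act_one hdm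
  coact_mul := map_mul (TAlg.coact ξ hdm)
  coact_one := map_one (TAlg.coact ξ hdm)

end TaftAdj

end

/-! A dinatural family with values in `Hom_K(H ⊗ M, M)` is determined by what it does at the regular
module. Naturality along the `K`-linear map `K → M`, `a ↦ a y`, shows that its `M`-component sends
`r ⊗ y` to `F(r) y`, where `F(r)` is the value at `r ⊗ 1` of the component at `K`
(`apply_eq_atReg`). The `K`-linearity of that component becomes the condition `F(a₋₁ r) a₀ = a F(r)`
(`atReg_central`), and every linear `F : H → K` with this property gives such a family. Hence the
end is the space of these `F`, on which `H` acts by right translation of the argument.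

For the Taft algebra the condition need only be read on the two generators of `K(d, ξ)`: `F(g ^ m r)
h = h F(r)` and `F(x r) + F(g r) w = w F(r)`. The first controls passing from `g ^ i` to `g ^ (i +
m)`, the second eliminates `x`, so `F` is known from `t_i = F(g ^ i)` for `0 ≤ i < m`. In these
coordinates right translation is exactly the action on `T(d, ξ)`; the factor `q ^ i` in the action
of `x` comes from `g ^ i x = q ^ i x g ^ i` (`TAlg.rho_ofLin`). Evaluation of `F` at `1` is the
projection `p` to the component `0`, and `F(r) = p(r · t)`.

`EndData` isolates what is needed of `p`, and the categorical part is proved from it for any Hopf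
algebra and comodule algebra. The compatibility with half-braidings (`EndData.pi_braid`) amounts to
`p` respecting coactions, together with the Yetter-Drinfeld condition in the form `IsCrossed`, which
does not involve the antipode. For an arbitrary adjoint algebra, the universal property gives a
bijection with `A` over the projections. It respects products because the projection to the regular
module is injective, and coactions because the half-braiding with the regular `H`-module recovers
the coaction (`EndData.coact_eq_of_pi`, `EndData.nonempty_iso`). -/

noncomputable section

namespace TaftAdj

section General

variable {k : Type u} [Field k]
variable {H : Type u} [Ring H] [HopfAlgebra k H] {K : Type u} [Ring K] [Algebra k K]

/-! ### The Yetter-Drinfeld condition without the antipode. -/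

section Cross

/-- The map `u ⊗ v ↦ (u · t)₋₁ v ⊗ (u · t)₀`. -/
def crossMap (A : YDAlg k H) (t : A.A) : H ⊗[k] H →ₗ[k] H ⊗[k] A.A :=
  LinearMap.mul' k (H ⊗[k] A.A) ∘ₗ
    TensorProduct.map (A.coact ∘ₗ A.ρ.toLinearMap.flip t) ((TensorProduct.mk k H A.A).flip 1)

theorem crossMap_tmul (A : YDAlg k H) (t : A.A) (u v : H) :
    crossMap A t (u ⊗ₜ v) = A.coact (A.ρ u t) * v ⊗ₜ 1 := rfl

theorem tensRho_lmul_mul_right (A : YDAlg k H) (z : H ⊗[k] H) (s : H ⊗[k] A.A) (v : H) :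
    tensRho (Algebra.lmul k H) A.ρ z (s * v ⊗ₜ 1) =
      tensRho (Algebra.lmul k H) A.ρ z s * v ⊗ₜ 1 := by
  induction z with
  | zero => simp
  | add a b ha hb => simp only [map_add, LinearMap.add_apply, ha, hb, add_mul]
  | tmul a b =>
    induction s with
    | zero => simp
    | add x y hx hy => simp only [add_mul, map_add, hx, hy]
    | tmul x y => simp [mul_assoc]

/-- The compatibility `(r₁ · t)₋₁ r₂ ⊗ (r₁ · t)₀ = r₁ t₋₁ ⊗ r₂ · t₀` at `r`. -/
def IsCrossed (A : YDAlg k H) (r : H) : Prop :=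
  ∀ t : A.A, crossMap A t (Coalgebra.comul (R := k) r) =
    tensRho (Algebra.lmul k H) A.ρ (Coalgebra.comul (R := k) r) (A.coact t)

/-- With `Δ(ab) = Δ(a) Δ(b)`, the condition for `a` is used at the vector `b₁ · t` and multiplied on
the right by `b₂ ⊗ 1`; then the condition for `b` applies. Hence the compatibility has to be checked
on algebra generators only. -/
theorem IsCrossed.mul {A : YDAlg k H} {a b : H} (ha : IsCrossed A a) (hb : IsCrossed A b) :
    IsCrossed A (a * b) := by
  intro t
  have key : ∀ w : H ⊗[k] H, crossMap A t (Coalgebra.comul (R := k) a * w) =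
      tensRho (Algebra.lmul k H) A.ρ (Coalgebra.comul (R := k) a) (crossMap A t w) := by
    intro w
    induction w with
    | zero => simp
    | add x y hx hy => simp only [mul_add, map_add, hx, hy]
    | tmul b₁ b₂ =>
      rw [crossMap_tmul, tensRho_lmul_mul_right, ← ha]
      generalize Coalgebra.comul (R := k) a = z
      induction z with
      | zero => simp
      | add x y hx hy => simp only [map_add, add_mul, hx, hy]
      | tmul u v =>
        rw [Algebra.TensorProduct.tmul_mul_tmul, crossMap_tmul, crossMap_tmul, map_mul, mul_assoc,
          Algebra.TensorProduct.tmul_mul_tmul, one_mul]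
        rfl
  rw [Bialgebra.comul_mul, key, hb, map_mul (tensRho _ _), Module.End.mul_apply]

theorem IsCrossed.add {A : YDAlg k H} {a b : H} (ha : IsCrossed A a) (hb : IsCrossed A b) :
    IsCrossed A (a + b) := by
  intro t
  simp only [map_add, LinearMap.add_apply, ha t, hb t]

theorem isCrossed_algebraMap (A : YDAlg k H) (a : k) : IsCrossed A (algebraMap k H a) := by
  intro t
  rw [Algebra.algebraMap_eq_smul_one, map_smul, map_smul, Bialgebra.comul_one, map_smul,
    LinearMap.smul_apply, map_one (tensRho _ _), Algebra.TensorProduct.one_def, crossMap_tmul,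
    map_one, ← Algebra.TensorProduct.one_def, mul_one]
  rfl

end Cross

/-! ### The end as a space of linear maps `H → K`. -/

/-- A map `p : A → K` whose associated maps `t ↦ (r ↦ p (r · t))` identify `A` with the linear maps
`F : H → K` such that `F(a₋₁ r) a₀ = a F(r)`. -/
structure EndData (c : LeftComodAlg k H K) (A : YDAlg k H) where
  p : A.A →ₐ[k] K
  -- The condition on `F = (r ↦ p (r · t))` at `r = 1`; replacing `t` by `r · t` gives it for every
  -- `r`.
  central : ∀ (a : K) (t : A.A), LinearMap.mul' k K (TensorProduct.map
    (p.toLinearMap ∘ₗ A.ρ.toLinearMap.flip t) LinearMap.id (c.coact a)) = a * p t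
  -- This and the next field yield the half-braiding.
  coact_p : ∀ t : A.A, c.coact (p t) = p.toLinearMap.lTensor H (A.coact t)
  crossed : ∀ r : H, IsCrossed A r
  ext : ∀ t t' : A.A, (∀ r : H, p (A.ρ r t) = p (A.ρ r t')) → t = t'
  -- A twisted form of `ext` with an extra factor `H`: it will show that the coaction is determined
  -- by the half-braiding.
  ext_tensor : ∀ w w' : H ⊗[k] A.A,
    (∀ r : H, p.toLinearMap.lTensor H (tensRho (Algebra.lmul k H) A.ρ (Coalgebra.comul (R := k) r) w)
      = p.toLinearMap.lTensor H (tensRho (Algebra.lmul k H) A.ρ (Coalgebra.comul (R := k) r) w')) →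
    w = w'
  exists_eq : ∀ F : H →ₗ[k] K, (∀ (a : K) (r : H), LinearMap.mul' k K (TensorProduct.map
    (F ∘ₗ LinearMap.mulRight k r) LinearMap.id (c.coact a)) = a * F r) →
    ∃ t : A.A, ∀ r : H, p (A.ρ r t) = F r

namespace EndData

variable {c : LeftComodAlg k H K} {A : YDAlg k H} (D : EndData c A)

/-- This is `central` at `r · t`, applied to a vector of `M`; it says that `r ⊗ y ↦ p (r · t) y` is
`K`-linear. -/
theorem piLin_aux (M : Repn k K) (t : A.A) (a : K) (v : H ⊗[k] M.V) :
    TensorProduct.lift (M.ρ.toLinearMap ∘ₗ D.p.toLinearMap ∘ₗ A.ρ.toLinearMap.flip t)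
      (tensRho (Algebra.lmul k H) M.ρ (c.coact a) v) =
    M.ρ a (TensorProduct.lift
      (M.ρ.toLinearMap ∘ₗ D.p.toLinearMap ∘ₗ A.ρ.toLinearMap.flip t) v) := by
  induction v with
  | zero => simp
  | add v w hv hw => simp only [map_add, hv, hw]
  | tmul r y =>
    have h := congrArg (fun b => M.ρ b y) (D.central a (A.ρ r t))
    simp only [map_mul, Module.End.mul_apply] at h
    refine Eq.trans ?_ h
    generalize c.coact a = z
    induction z with
    | zero => simp
    | add x y hx hy => simp only [map_add, LinearMap.add_apply, hx, hy]
    | tmul u b => simp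

/-- The map `A → Hom_K(H ⊗ M, M)`, `t ↦ (r ⊗ y ↦ p (r · t) y)`. -/
def piLin (M : Repn k K) : A.A →ₗ[k] homSpace c M.ρ M.ρ where
  toFun t := ⟨TensorProduct.lift (M.ρ.toLinearMap ∘ₗ D.p.toLinearMap ∘ₗ A.ρ.toLinearMap.flip t),
    D.piLin_aux M t⟩
  map_add' t t' := by
    apply Subtype.ext
    apply TensorProduct.ext'
    intro r y
    simp
  map_smul' a t := by
    apply Subtype.ext
    apply TensorProduct.ext'
    intro r y
    simp

theorem piLin_tmul (M : Repn k K) (t : A.A) (r : H) (y : M.V) :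
    (D.piLin M t).1 (r ⊗ₜ y) = M.ρ (D.p (A.ρ r t)) y := rfl

variable [FiniteDimensional k H]

/-- The projections of the end. -/
def pi (M : Repn k K) : Repn.Hom A.toRepn (Repn.ihom c M M) where
  lin := D.piLin M
  comm h t := by
    apply Subtype.ext
    apply TensorProduct.ext'
    intro r y
    change M.ρ (D.p (A.ρ r (A.ρ h t))) y = M.ρ (D.p (A.ρ (r * h) t)) y
    rw [map_mul]
    rfl

end EndData

/-! ### Element formulas for the structure maps of the internal Hom. -/

namespace Repn

variable [FiniteDimensional k H]

/-- In this formula and the following ones, `psi` lets `r` act on the source and `ev` then evaluates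
at `1`, which leaves an argument `1 * r`. -/
theorem ihomMap_tmul (c : LeftComodAlg k H K) (M : Repn k K) {N N' : Repn k K} (f : Hom N N')
    (α : homSpace c M.ρ N.ρ) (r : H) (y : M.V) :
    ((ihomMap c M f).lin α : homSpace c M.ρ N'.ρ).1 (r ⊗ₜ y) = f.lin (α.1 (r ⊗ₜ y)) := by
  change f.lin (α.1 ((1 * r) ⊗ₜ y)) = _
  rw [one_mul]

theorem ihomPre_tmul (c : LeftComodAlg k H K) {M M' : Repn k K} (f : Hom M M') (N : Repn k K)
    (α : homSpace c M'.ρ N.ρ) (r : H) (y : M.V) :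
    ((ihomPre c f N).lin α : homSpace c M.ρ N.ρ).1 (r ⊗ₜ y) = α.1 (r ⊗ₜ f.lin y) := by
  change α.1 ((1 * r) ⊗ₜ f.lin y) = _
  rw [one_mul]

/-- The map `u ⊗ v ↦ α(u ⊗ β(v ⊗ y))`. -/
def compMap (c : LeftComodAlg k H K) (M₁ M₂ M₃ : Repn k K) (α : homSpace c M₂.ρ M₃.ρ)
    (β : homSpace c M₁.ρ M₂.ρ) (y : M₁.V) : H ⊗[k] H →ₗ[k] M₃.V :=
  α.1 ∘ₗ TensorProduct.map LinearMap.id (β.1 ∘ₗ (TensorProduct.mk k H M₁.V).flip y)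

/-- The element `r` acts on `α ⊗ β` through its coproduct: `r₁` shifts the argument of `α` and `r₂`
that of `β`. -/
theorem icomp_tmul (c : LeftComodAlg k H K) (M₁ M₂ M₃ : Repn k K) (α : homSpace c M₂.ρ M₃.ρ)
    (β : homSpace c M₁.ρ M₂.ρ) (r : H) (y : M₁.V) :
    ((icomp c M₁ M₂ M₃).lin (α ⊗ₜ[k] β) : homSpace c M₁.ρ M₃.ρ).1 (r ⊗ₜ y) =
      compMap c M₁ M₂ M₃ α β y (Coalgebra.comul (R := k) r) := by
  -- The coproduct is replaced by an arbitrary tensor `z`, so that linearity reduces the claim to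
  -- pure tensors; the same device recurs below.
  have key : ∀ z : H ⊗[k] H, evLin c M₂.ρ M₃.ρ (TensorProduct.map LinearMap.id
      (evLin c M₁.ρ M₂.ρ) (TensorProduct.assoc k _ _ _
        (tensRho (homRho c M₂.ρ M₃.ρ) (homRho c M₁.ρ M₂.ρ) z (α ⊗ₜ β) ⊗ₜ y))) =
      compMap c M₁ M₂ M₃ α β y z := by
    intro z
    induction z with
    | zero => simp
    | add a b ha hb => simp only [map_add, LinearMap.add_apply, TensorProduct.add_tmul, ha, hb]
    | tmul u v => simp [compMap]
  exact key _

theorem icoev_tmul (c : LeftComodAlg k H K) (M : Repn k K) (a : k) (r : H) (y : M.V) :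
    ((icoev c M).lin a : homSpace c M.ρ M.ρ).1 (r ⊗ₜ y) =
      (Coalgebra.counit (R := k) r * a) • y := rfl

/-- The map `u ⊗ v ↦ u · x ⊗ α(v ⊗ y)`. -/
def aMap (c : LeftComodAlg k H K) (X : Repn k H) (M N : Repn k K) (x : X.V)
    (α : homSpace c M.ρ N.ρ) (y : M.V) : H ⊗[k] H →ₗ[k] X.V ⊗[k] N.V :=
  TensorProduct.map (X.ρ.toLinearMap.flip x) (α.1 ∘ₗ (TensorProduct.mk k H M.V).flip y)

theorem iaInv_tmul (c : LeftComodAlg k H K) (X : Repn k H) (M N : Repn k K) (x : X.V)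
    (α : homSpace c M.ρ N.ρ) (r : H) (y : M.V) :
    ((iaInv c X M N).lin (x ⊗ₜ[k] α) : homSpace c M.ρ (act c X N).ρ).1 (r ⊗ₜ y) =
      aMap c X M N x α y (Coalgebra.comul (R := k) r) := by
  have key : ∀ z : H ⊗[k] H, TensorProduct.map LinearMap.id
      (evLin c M.ρ N.ρ) (TensorProduct.assoc k _ _ _
        (tensRho X.ρ (homRho c M.ρ N.ρ) z (x ⊗ₜ α) ⊗ₜ y)) = aMap c X M N x α y z := by
    intro z
    induction z with
    | zero => simp
    | add a b ha hb => simp only [map_add, LinearMap.add_apply, TensorProduct.add_tmul, ha, hb]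
    | tmul u v => simp [aMap]
  exact key _

/-- The linear map underlying `iaInv`. -/
def iaInvLin (c : LeftComodAlg k H K) (X : Repn k H) (M N : Repn k K) :
    X.V ⊗[k] homSpace c M.ρ N.ρ →ₗ[k] homSpace c M.ρ ((tensRho X.ρ N.ρ).comp c.coact) :=
  (iaInv c X M N).lin

/-- The map `u ⊗ v ↦ α(u ⊗ (v · x ⊗ y))`. -/
def bMap (c : LeftComodAlg k H K) (X : Repn k H) (M N : Repn k K)
    (α : homSpace c (act c X M).ρ N.ρ) (x : X.V) (y : M.V) : H ⊗[k] H →ₗ[k] N.V :=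
  α.1 ∘ₗ TensorProduct.map LinearMap.id
    ((TensorProduct.mk k X.V M.V).flip y ∘ₗ X.ρ.toLinearMap.flip x)

theorem ib_tmul (c : LeftComodAlg k H K) (X : Repn k H) (M N : Repn k K)
    (α : homSpace c (act c X M).ρ N.ρ) (x : X.V) (r : H) (y : M.V) :
    ((ib c X M N).lin (α ⊗ₜ[k] x) : homSpace c M.ρ N.ρ).1 (r ⊗ₜ y) =
      bMap c X M N α x y (Coalgebra.comul (R := k) r) := by
  let e : (homSpace c (act c X M).ρ N.ρ ⊗[k] X.V) ⊗[k] M.V →ₗ[k] N.V :=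
    evLin c (act c X M).ρ N.ρ ∘ₗ (TensorProduct.assoc k _ X.V M.V).toLinearMap
  have key : ∀ z : H ⊗[k] H,
      e (tensRho (homRho c (act c X M).ρ N.ρ) X.ρ z (α ⊗ₜ x) ⊗ₜ y) = bMap c X M N α x y z := by
    intro z
    induction z with
    | zero => simp
    | add a b ha hb => simp only [map_add, LinearMap.add_apply, TensorProduct.add_tmul, ha, hb]
    | tmul u v =>
      rw [tensRho_tmul]
      change α.1 ((1 * u) ⊗ₜ _) = _
      rw [one_mul]
      rfl
  exact key _

end Repn

/-- The regular representation. -/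
def Repn.reg (K : Type u) [Ring K] [Algebra k K] [FiniteDimensional k K] : Repn k K where
  V := K
  ρ := Algebra.lmul k K

theorem Repn.Hom.comp_assoc {B : Type u} [Ring B] [Algebra k B] {L M N P : Repn k B}
    (f : Hom N P) (g : Hom M N) (h : Hom L M) : (f.comp g).comp h = f.comp (g.comp h) := rfl

theorem Repn.Hom.comp_id {B : Type u} [Ring B] [Algebra k B] {M N : Repn k B}
    (f : Hom M N) : f.comp (Hom.id M) = f := rfl

/-! ### Compatibility of the projections with maps, products and half-braidings. -/

namespace EndData

variable {c : LeftComodAlg k H K} {A : YDAlg k H} (D : EndData c A) [FiniteDimensional k H]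

/-- The `M`-component acts through an element of `K` independent of `M`, and module maps commute
with it. -/
theorem isDinatural_pi : IsDinatural c D.pi := by
  intro M N f
  apply Repn.Hom.ext
  apply LinearMap.ext
  intro t
  apply Subtype.ext
  apply TensorProduct.ext'
  intro r y
  exact (Repn.ihomMap_tmul c M f (D.piLin M t) r y).trans
    ((f.comm _ _).trans (Repn.ihomPre_tmul c f N (D.piLin N t) r y).symm)

/-- Composition splits `r` by its coproduct, as does the module algebra rule `r · (ab) = (r₁ · a)(r₂
· b)`; multiplicativity of `p` does the rest. -/
theorem pi_mul (M : Repn k K) (a b : A.A) :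
    (D.pi M).lin (a * b : A.A) = (Repn.icomp c M M M).lin ((D.pi M).lin a ⊗ₜ (D.pi M).lin b) := by
  apply Subtype.ext
  apply TensorProduct.ext'
  intro r y
  refine Eq.trans ?_ (Repn.icomp_tmul c M M M (D.piLin M a) (D.piLin M b) r y).symm
  change M.ρ (D.p (A.ρ r (a * b))) y = _
  rw [A.act_mul]
  generalize Coalgebra.comul (R := k) r = z
  induction z with
  | zero => simp
  | add u v hu hv => simp only [map_add, LinearMap.add_apply, hu, hv]
  | tmul u v => simp [Repn.compMap, piLin_tmul]

theorem pi_one (M : Repn k K) :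
    (D.pi M).lin (1 : A.A) = (Repn.icoev c M).lin (1 : k) := by
  apply Subtype.ext
  apply TensorProduct.ext'
  intro r y
  refine Eq.trans ?_ (Repn.icoev_tmul c M 1 r y).symm
  change M.ρ (D.p (A.ρ r 1)) y = _
  rw [A.act_one, map_smul, map_smul, map_one, map_one, mul_one]
  rfl

/-- For `w = s ⊗ t` both sides are `r₁ s · x ⊗ p (r₂ · t) y`. The tensor `w` is left arbitrary
because the formula serves twice: for the coaction of `A`, and to compare that coaction with one
carried over from another adjoint algebra. -/
theorem iaInv_pi (X : Repn k H) (M : Repn k K) (x : X.V) (w : H ⊗[k] A.A) (r : H) (y : M.V) :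
    (Repn.iaInvLin c X M M ((D.piLin M).lTensor X.V
      (TensorProduct.map (X.ρ.toLinearMap.flip x) LinearMap.id w))).1 (r ⊗ₜ y) =
    tensRho X.ρ M.ρ (D.p.toLinearMap.lTensor H
      (tensRho (Algebra.lmul k H) A.ρ (Coalgebra.comul (R := k) r) w)) (x ⊗ₜ y) := by
  induction w with
  | zero => simp
  | add w w' h h' =>
    simp only [map_add, LinearMap.add_apply, ← h, ← h']
    rfl
  | tmul s t =>
    refine (Repn.iaInv_tmul c X M M (X.ρ s x) (D.piLin M t) r y).trans ?_
    generalize Coalgebra.comul (R := k) r = z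
    induction z with
    | zero => simp; rfl
    | add u v hu hv => simp only [map_add, LinearMap.add_apply, hu, hv]; rfl
    | tmul u v => simp [Repn.aMap, piLin_tmul]; rfl

/-- At `r ⊗ y` the left side is `p (r₁ · t)` acting on `r₂ · x ⊗ y`, that is `(r₁ · t)₋₁ r₂ · x ⊗ p
((r₁ · t)₀) y` by `coact_p`; the right side is `r₁ t₋₁ · x ⊗ p (r₂ · t₀) y`. The field `crossed`
identifies them. -/
theorem pi_braid (X : Repn k H) (M : Repn k K) (t : A.A) (x : X.V) :
    (Repn.ib c X M (Repn.act c X M)).lin ((D.pi (Repn.act c X M)).lin t ⊗ₜ x) =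
      (Repn.iaInv c X M M).lin ((D.pi M).lin.lTensor X.V (A.braid X (t ⊗ₜ x))) := by
  apply Subtype.ext
  apply TensorProduct.ext'
  intro r y
  refine Eq.trans ?_ (D.iaInv_pi X M x (A.coact t) r y).symm
  refine (Repn.ib_tmul c X M (Repn.act c X M) (D.piLin (Repn.act c X M) t) x r y).trans ?_
  rw [← D.crossed r t]
  generalize Coalgebra.comul (R := k) r = z
  have hp : ∀ (s : H ⊗[k] A.A) (v : H), D.p.toLinearMap.lTensor H (s * v ⊗ₜ 1) =
      D.p.toLinearMap.lTensor H s * v ⊗ₜ 1 := by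
    intro s v
    induction s with
    | zero => simp
    | add u v hu hv => simp only [map_add, add_mul, hu, hv]
    | tmul a b => simp
  induction z with
  | zero => simp; rfl
  | add u v hu hv => simp only [map_add, LinearMap.add_apply, hu, hv]; rfl
  | tmul u v =>
    -- The factor `v ⊗ 1` acts on `x ⊗ y` first, and what remains is the action of `p (u · t)` on `X
    -- ▷ M` through the coaction of `K`.
    rw [crossMap_tmul, hp, ← D.coact_p, map_mul (tensRho _ _), Module.End.mul_apply, tensRho_tmul,
      map_one, Module.End.one_apply]
    rfl

/-! ### The universal property, read off at the regular module. -/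

section Universal

variable {E : Repn k H} {ζ : ∀ M : Repn k K, Repn.Hom E (Repn.ihom c M M)}

theorem dinatural_apply (hζ : IsDinatural c ζ) {M N : Repn k K} (f : Repn.Hom M N) (e : E.V)
    (r : H) (y : M.V) :
    f.lin (((ζ M).lin e : homSpace c M.ρ M.ρ).1 (r ⊗ₜ y)) =
      ((ζ N).lin e : homSpace c N.ρ N.ρ).1 (r ⊗ₜ f.lin y) := by
  have h := congrArg (fun g : Repn.Hom E (Repn.ihom c M N) =>
    (g.lin e : homSpace c M.ρ N.ρ).1 (r ⊗ₜ y)) (hζ M N f)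
  exact (Repn.ihomMap_tmul c M f _ r y).symm.trans (h.trans (Repn.ihomPre_tmul c f N _ r y))

variable [FiniteDimensional k K]

/-- The map `r ↦ ζ(e)(r ⊗ 1)` at the regular representation. -/
def atReg (ζ : ∀ M : Repn k K, Repn.Hom E (Repn.ihom c M M)) (e : E.V) : H →ₗ[k] K :=
  ((ζ (Repn.reg K)).lin e : homSpace c (Algebra.lmul k K) (Algebra.lmul k K)).1 ∘ₗ
    (TensorProduct.mk k H K).flip 1

/-- Dinaturality along the module map `K → M`, `a ↦ a y`, evaluated at `r ⊗ 1`. -/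
theorem apply_eq_atReg (hζ : IsDinatural c ζ) (M : Repn k K) (e : E.V) (r : H) (y : M.V) :
    ((ζ M).lin e : homSpace c M.ρ M.ρ).1 (r ⊗ₜ y) = M.ρ (atReg ζ e r) y := by
  let f : Repn.Hom (Repn.reg K) M := ⟨M.ρ.toLinearMap.flip y, fun a (v : K) => by
    change M.ρ (a * v) y = M.ρ a (M.ρ v y)
    rw [map_mul]; rfl⟩
  have h := dinatural_apply hζ f e r (1 : K)
  have h1 : f.lin (1 : K) = y := by
    change M.ρ 1 y = y
    rw [map_one]; rfl
  rw [h1] at h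
  exact h.symm

/-- The component at `K` is left `K`-linear, and by `apply_eq_atReg` it satisfies `α(u ⊗ b) = α(u ⊗
1) b`; the second fact turns the `a₀` inside the argument into a right factor. -/
theorem atReg_central (hζ : IsDinatural c ζ) (e : E.V) (a : K) (r : H) :
    LinearMap.mul' k K (TensorProduct.map (atReg ζ e ∘ₗ LinearMap.mulRight k r) LinearMap.id
      (c.coact a)) = a * atReg ζ e r := by
  let α : homSpace c (Algebra.lmul k K) (Algebra.lmul k K) := (ζ (Repn.reg K)).lin e
  have h : ∀ (u : H) (b : K), α.1 (u ⊗ₜ b) = α.1 (u ⊗ₜ 1) * b :=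
    fun u b => apply_eq_atReg hζ (Repn.reg K) e u b
  refine Eq.trans ?_ (α.2 a (r ⊗ₜ 1))
  generalize c.coact a = z
  induction z with
  | zero => simp
  | add u v hu hv => simp only [map_add, LinearMap.add_apply, hu, hv]
  | tmul u b =>
    rw [tensRho_tmul, TensorProduct.map_tmul, LinearMap.mul'_apply, Algebra.coe_lmul_eq_mul,
      Algebra.coe_lmul_eq_mul, LinearMap.mul_apply', LinearMap.mul_apply', mul_one, h]
    rfl

theorem atReg_act (e : E.V) (h r : H) : atReg ζ (E.ρ h e) r = atReg ζ e (r * h) :=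
  congrArg (fun α : homSpace c (Algebra.lmul k K) (Algebra.lmul k K) => α.1 (r ⊗ₜ (1 : K)))
    ((ζ (Repn.reg K)).comm h e)

/-- Evaluation at `r ⊗ 1` recovers `p (r · t)` for all `r`, so `ext` applies. -/
theorem pi_injective {t t' : A.A}
    (h : (D.pi (Repn.reg K)).lin t = (D.pi (Repn.reg K)).lin t') : t = t' := by
  apply D.ext
  intro r
  have e := congrArg (fun α : homSpace c (Algebra.lmul k K) (Algebra.lmul k K) =>
    α.1 (r ⊗ₜ (1 : K))) h
  have e' : D.p (A.ρ r t) * 1 = D.p (A.ρ r t') * 1 := e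
  rwa [mul_one, mul_one] at e'

/-- The field `exists_eq` supplies the value at each vector `e`. Since `ext` makes this value
unique, linearity and `H`-linearity of the resulting map are inherited from `atReg`. -/
theorem pi_universal (E : Repn k H) (ζ : ∀ M : Repn k K, Repn.Hom E (Repn.ihom c M M))
    (hζ : IsDinatural c ζ) :
    ∃! f : Repn.Hom E A.toRepn, ∀ M, (D.pi M).comp f = ζ M := by
  choose f hf using fun e => D.exists_eq (atReg ζ e) (atReg_central hζ e)
  let F : E.V →ₗ[k] A.A :=
    { toFun := f
      map_add' := fun e e' => D.ext _ _ fun r => by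
        rw [hf, map_add, map_add, hf, hf]
        simp only [atReg, map_add]
        rfl
      map_smul' := fun a e => D.ext _ _ fun r => by
        rw [hf, RingHom.id_apply, map_smul, map_smul, hf]
        simp only [atReg, map_smul]
        rfl }
  refine ⟨⟨F, fun h e => D.ext _ _ fun r => ?_⟩, fun M => ?_, fun f' hf' => ?_⟩
  · change D.p (A.ρ r (f (E.ρ h e))) = D.p (A.ρ r (A.ρ h (f e)))
    rw [hf, atReg_act, ← hf, map_mul]
    rfl
  · apply Repn.Hom.ext
    apply LinearMap.ext
    intro e
    apply Subtype.ext
    apply TensorProduct.ext'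
    intro r y
    refine Eq.trans ?_ (apply_eq_atReg hζ M e r y).symm
    change M.ρ (D.p (A.ρ r (f e))) y = _
    rw [hf]
  · apply Repn.Hom.ext
    apply LinearMap.ext
    intro e
    apply D.ext
    intro r
    -- The regular component at `r ⊗ 1` already forces `f'` to agree with `f`.
    have h := congrArg (fun g : Repn.Hom E (Repn.ihom c (Repn.reg K) (Repn.reg K)) =>
      (g.lin e : homSpace c (Algebra.lmul k K) (Algebra.lmul k K)).1 (r ⊗ₜ (1 : K))) (hf' (Repn.reg K))
    have h' : D.p (A.ρ r (f'.lin e)) * 1 = atReg ζ e r := h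
    rw [mul_one] at h'
    exact h'.trans (hf e r).symm

/-- The adjoint algebra. -/
def adjointAlgebra : AdjointAlgebra c where
  toYDAlg := A
  π := D.pi
  dinatural := D.isDinatural_pi
  universal := D.pi_universal
  braid_compat := D.pi_braid
  mul_compat := D.pi_mul
  one_compat := D.pi_one

/-! ### Uniqueness of the adjoint algebra. -/

/-- For `X = H` and `x = 1` the half-braiding sends `a ⊗ 1` to `a₋₁ ⊗ a₀`, so it contains the whole
coaction. The braiding axioms for `S` and for `A` have the same left side, since `f` respects the
projections; comparing the right sides at `r ⊗ 1` in the regular `K`-module gives the hypothesis of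
`ext_tensor`. -/
theorem coact_eq_of_pi (S : AdjointAlgebra c) (f : Repn.Hom S.toYDAlg.toRepn A.toRepn)
    (hf : ∀ M, (D.pi M).comp f = S.π M) (a : S.toYDAlg.A) :
    A.coact (f.lin a : A.A) =
      (f.lin : S.toYDAlg.A →ₗ[k] A.A).lTensor H (S.toYDAlg.coact a) := by
  let f₀ : S.toYDAlg.A →ₗ[k] A.A := f.lin
  let X : Repn k H := Repn.reg H
  let M : Repn k K := Repn.reg K
  have hl : ∀ N, (S.π N).lin = (D.pi N).lin ∘ₗ f.lin := fun N => (congrArg Repn.Hom.lin (hf N)).symm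
  let x : X.V := (1 : H)
  have h1 := S.braid_compat X M a x
  have h2 := D.pi_braid X M (f₀ a) x
  rw [hl, hl] at h1
  have h3 : ∀ w : H ⊗[k] S.toYDAlg.A, (D.piLin M ∘ₗ f₀).lTensor X.V
      (TensorProduct.map (X.ρ.toLinearMap.flip x) LinearMap.id w) =
      (D.piLin M).lTensor X.V (TensorProduct.map (X.ρ.toLinearMap.flip x) LinearMap.id
        (f₀.lTensor H w)) := by
    intro w
    induction w with
    | zero => simp
    | add u v hu hv => simp only [map_add, hu, hv]
    | tmul u v => rfl
  have h5 : Repn.iaInvLin c X M M ((D.piLin M).lTensor X.V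
      (TensorProduct.map (X.ρ.toLinearMap.flip x) LinearMap.id (A.coact (f₀ a)))) =
      Repn.iaInvLin c X M M ((D.piLin M).lTensor X.V
      (TensorProduct.map (X.ρ.toLinearMap.flip x) LinearMap.id
        (f₀.lTensor H (S.toYDAlg.coact a)))) :=
    h2.symm.trans (h1.trans (congrArg (Repn.iaInvLin c X M M) (h3 (S.toYDAlg.coact a))))
  apply D.ext_tensor
  intro r
  let y : M.V := (1 : K)
  have h6 := congrArg (fun α => α.1 (r ⊗ₜ y)) h5
  have h7 := (D.iaInv_pi X M x (A.coact (f₀ a)) r y).symm.trans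
    (h6.trans (D.iaInv_pi X M x (f₀.lTensor H (S.toYDAlg.coact a)) r y))
  -- Acting on `1 ⊗ 1` in the regular modules loses nothing.
  have h8 : ∀ z : H ⊗[k] K, tensRho X.ρ M.ρ z (x ⊗ₜ y) = z := by
    intro z
    induction z with
    | zero => rw [map_zero]; rfl
    | add u v hu hv => rw [map_add, LinearMap.add_apply, hu, hv]; rfl
    | tmul u v =>
      rw [tensRho_tmul]
      change (u * 1) ⊗ₜ[k] (v * 1) = _
      rw [mul_one, mul_one]
  exact (h8 _).symm.trans (h7.trans (h8 _))

/-- Two ends are isomorphic over their projections. Products and units are determined by the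
projections, and `pi_injective` transfers the equalities back to `A`. -/
theorem nonempty_iso (D : EndData c A) (S : AdjointAlgebra c) : Nonempty (YDAlg.Iso S.toYDAlg A) := by
  obtain ⟨f, hf, -⟩ := D.pi_universal _ S.π S.dinatural
  obtain ⟨g, hg, -⟩ := S.universal _ D.pi D.isDinatural_pi
  have hgf : g.comp f = Repn.Hom.id _ :=
    (S.universal _ S.π S.dinatural).unique
      (fun M => by rw [← Repn.Hom.comp_assoc, hg, hf]) fun M => Repn.Hom.comp_id _
  have hfg : f.comp g = Repn.Hom.id _ :=
    (D.pi_universal _ D.pi D.isDinatural_pi).unique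
      (fun M => by rw [← Repn.Hom.comp_assoc, hf, hg]) fun M => Repn.Hom.comp_id _
  let f₀ : S.toYDAlg.A →ₗ[k] A.A := f.lin
  let g₀ : A.A →ₗ[k] S.toYDAlg.A := g.lin
  have hπ : ∀ a : S.toYDAlg.A, (D.pi (Repn.reg K)).lin (f₀ a) = (S.π (Repn.reg K)).lin a :=
    fun a => congrArg (fun h => h.lin a) (hf (Repn.reg K))
  let e : S.toYDAlg.A ≃ₗ[k] A.A := LinearEquiv.ofLinearMap f₀ g₀
    (congrArg Repn.Hom.lin hfg) (congrArg Repn.Hom.lin hgf)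
  refine ⟨⟨AlgEquiv.ofLinearEquiv e ?_ ?_, f.comm, D.coact_eq_of_pi S f hf⟩⟩
  · apply D.pi_injective
    exact (hπ 1).trans ((S.one_compat _).trans (D.pi_one _).symm)
  · intro a b
    apply D.pi_injective
    refine (hπ (a * b)).trans ((S.mul_compat _ a b).trans ?_)
    rw [← hπ a, ← hπ b]
    exact (D.pi_mul _ (f₀ a) (f₀ b)).symm

end Universal

end EndData

end General

/-! ### The Taft algebra: `T(d, ξ)` with its component `0`. -/

section Taft

variable {k : Type u} [Field k] {d m n : ℕ} {q : k} [NeZero n] [hq : Fact (IsPrimitiveRoot q n)]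

/-- The Yetter-Drinfeld condition carries the factor `S(r₃)`, which the extra right factor cancels.
For `g` this is `g⁻¹ g = 1`; for `x` the term `- g t₋₁ g⁻¹ x ⊗ g · t₀` coming from `S(x)` is
cancelled by the coaction of `g · t` multiplied by `x ⊗ 1`. -/
theorem isCrossed_TAlg (ξ : k) (hdm : d * m = n) (r : Taft k n q) :
    IsCrossed (TAlg (q := q) ξ hdm) r := by
  induction r using QAlg.induction with
  | ha a => exact isCrossed_algebraMap _ a
  | hadd a b ha hb => exact ha.add hb
  | hmul a b ha hb => exact ha.mul hb
  | hh =>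
    intro t
    have h := (TAlg (q := q) ξ hdm).yetterDrinfeld Taft.g t
    rw [Taft.comul_g, LinearMap.lTensor_tmul, Taft.comul_g] at h
    rw [Taft.comul_g, crossMap_tmul, h]
    generalize (TAlg (q := q) ξ hdm).coact t = z
    induction z with
    | zero => simp
    | add u v hu hv => simp only [map_add, add_mul, hu, hv]
    | tmul u v =>
      rw [ydOp_tmul, Algebra.TensorProduct.tmul_mul_tmul, tensRho_tmul, TAlg.antipode_g, mul_one,
        mul_assoc, mul_assoc, QAlg.hinv_mul_h (NeZero.ne n), mul_one]
      rfl
  | hw =>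
    intro t
    have h := (TAlg (q := q) ξ hdm).yetterDrinfeld Taft.g t
    rw [Taft.comul_g, LinearMap.lTensor_tmul, Taft.comul_g] at h
    have h' := (TAlg (q := q) ξ hdm).yetterDrinfeld Taft.x t
    rw [Taft.comul_x, map_add, LinearMap.lTensor_tmul, LinearMap.lTensor_tmul,
      Taft.comul_x, Bialgebra.comul_one, Algebra.TensorProduct.one_def, TensorProduct.tmul_add] at h'
    rw [Taft.comul_x, map_add, crossMap_tmul, crossMap_tmul, h, h']
    generalize (TAlg (q := q) ξ hdm).coact t = z
    induction z with
    | zero => simp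
    | add u v hu hv =>
      simp only [map_add, LinearMap.add_apply, add_mul] at hu hv ⊢
      have huv := congrArg₂ (· + ·) hu hv
      rw [← huv]
      abel
    | tmul u v =>
      simp only [map_add, LinearMap.add_apply, add_mul]
      simp only [ydOp_tmul, Algebra.TensorProduct.tmul_mul_tmul, tensRho_tmul, TAlg.antipode_g,
        TAlg.antipode_x, mul_one, HopfAlgebra.antipode_one, map_one, Module.End.one_apply,
        mul_neg, neg_mul, TensorProduct.neg_tmul, mul_assoc]
      rw [Algebra.coe_lmul_eq_mul, LinearMap.mul_apply', LinearMap.mul_apply']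
      abel

theorem m_pos (hdm : d * m = n) : 0 < m :=
  Nat.pos_of_ne_zero fun h => NeZero.ne n (by rw [← hdm, h, mul_zero])

/-- The projection of `T(d, ξ)` to its first component. -/
def TAlg.first (ξ : k) (hdm : d * m = n) : (Fin m → KAlg k d m n q ξ) →ₐ[k] KAlg k d m n q ξ :=
  Pi.evalAlgHom k _ ⟨0, m_pos hdm⟩

/-- As `i < m`, the shift by `i` does not wrap around and no conjugation by `h` occurs. So the
component `0` along the powers of `g` sees every component, which gives both injectivity conditions.
-/
theorem TAlg.first_g_pow (ξ : k) (hdm : d * m = n) (t : Fin m → KAlg k d m n q ξ) (i : Fin m) :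
    TAlg.first ξ hdm (TAlg.rho ξ hdm ((Taft.g : Taft k n q) ^ (i : ℕ)) t) = t i := by
  rw [TAlg.rho_g_pow]
  change TAlg.gOp d m n q ξ i t ⟨0, m_pos hdm⟩ = t i
  rw [TAlg.gOp_apply]
  simp [Nat.div_eq_of_lt i.2, Nat.mod_eq_of_lt i.2]

/-- The condition is multiplicative in the element of `K`: in `f(a₋₁ b₋₁ · z) a₀ b₀` the rule for
`a` is used at `b₋₁ · z`, and then the rule for `b` at `z`. This reduces `central` to the
generators. -/
theorem mul'_map_coact_mul {ξ : k} {Z : Type u} [AddCommGroup Z] [Module k Z]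
    (c : LeftComodAlg k (Taft k n q) (KAlg k d m n q ξ))
    (ρ : Taft k n q →ₐ[k] Module.End k Z) (f : Z →ₗ[k] KAlg k d m n q ξ)
    (a b : KAlg k d m n q ξ)
    (ha : ∀ z, LinearMap.mul' k _ (TensorProduct.map (f ∘ₗ ρ.toLinearMap.flip z) LinearMap.id
      (c.coact a)) = a * f z)
    (hb : ∀ z, LinearMap.mul' k _ (TensorProduct.map (f ∘ₗ ρ.toLinearMap.flip z) LinearMap.id
      (c.coact b)) = b * f z) (z : Z) :
    LinearMap.mul' k _ (TensorProduct.map (f ∘ₗ ρ.toLinearMap.flip z) LinearMap.id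
      (c.coact (a * b))) = a * b * f z := by
  rw [map_mul, mul_assoc, ← hb]
  have key : ∀ w, LinearMap.mul' k _ (TensorProduct.map (f ∘ₗ ρ.toLinearMap.flip z) LinearMap.id
      (c.coact a * w)) = a * LinearMap.mul' k _ (TensorProduct.map (f ∘ₗ ρ.toLinearMap.flip z)
        LinearMap.id w) := by
    intro w
    induction w with
    | zero => simp
    | add u v hu hv => simp only [mul_add, map_add, hu, hv]
    | tmul u v =>
      have h := congrArg (· * v) (ha (ρ u z))
      simp only [mul_assoc] at h
      rw [TensorProduct.map_tmul, LinearMap.mul'_apply]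
      refine Eq.trans ?_ h
      generalize c.coact a = s
      induction s with
      | zero => simp
      | add u v hu hv => simp only [add_mul, map_add, hu, hv]
      | tmul u v => simp [mul_assoc]
  exact key _

theorem TAlg.first_central (ξ : k) (hdm : d * m = n) (a : KAlg k d m n q ξ)
    (t : Fin m → KAlg k d m n q ξ) :
    LinearMap.mul' k _ (TensorProduct.map ((TAlg.first ξ hdm).toLinearMap ∘ₗ
      (TAlg.rho ξ hdm).toLinearMap.flip t) LinearMap.id
        ((KAlg.comodAlg (q := q) ξ hdm).coact a)) = a * TAlg.first ξ hdm t := by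
  induction a using QAlg.induction generalizing t with
  | ha a =>
    rw [AlgHom.commutes, Algebra.TensorProduct.algebraMap_apply, TensorProduct.map_tmul,
      LinearMap.mul'_apply]
    simp [Algebra.algebraMap_eq_smul_one]
  | hadd a b ha hb => simp only [map_add, add_mul, ha, hb]
  | hmul a b ha hb => exact mul'_map_coact_mul _ _ _ a b ha hb t
  | hh =>
    have e : (KAlg.comodAlg (q := q) ξ hdm).coact QAlg.h = (Taft.g ^ m) ⊗ₜ QAlg.h :=
      KAlg.coactHom_h hdm
    rw [e, TensorProduct.map_tmul, LinearMap.mul'_apply]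
    change TAlg.rho ξ hdm (Taft.g ^ m) t ⟨0, m_pos hdm⟩ * QAlg.h = QAlg.h * t ⟨0, m_pos hdm⟩
    rw [TAlg.rho_g_pow, TAlg.gOp_apply]
    -- The shift by `m` returns to the component `0` after one wrap, so `(g ^ m · t)_0 = h t_0 h⁻¹`.
    simp [Nat.div_self (m_pos hdm), mul_assoc, QAlg.hinv_mul_h (TAlg.ne_zero_left hdm)]
  | hw =>
    have e : (KAlg.comodAlg (q := q) ξ hdm).coact QAlg.w = Taft.x ⊗ₜ 1 + Taft.g ⊗ₜ QAlg.w :=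
      KAlg.coactHom_w hdm
    rw [e, map_add, map_add, TensorProduct.map_tmul, TensorProduct.map_tmul, LinearMap.mul'_apply,
      LinearMap.mul'_apply]
    change TAlg.rho ξ hdm Taft.x t ⟨0, m_pos hdm⟩ * 1 +
      TAlg.rho ξ hdm Taft.g t ⟨0, m_pos hdm⟩ * QAlg.w = QAlg.w * t ⟨0, m_pos hdm⟩
    rw [TAlg.rho_x, TAlg.rho_g, mul_one]
    -- At the component `0` the scalar is `1`, and the rule for `w` is the definition of the action
    -- of `x`.
    change q ^ 0 • (QAlg.w * t _ - TAlg.gOp d m n q ξ 1 t ⟨0, m_pos hdm⟩ * QAlg.w) + _ = _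
    rw [pow_zero, one_smul, sub_add_cancel]

/-- The twist of the coaction by `g ^ i` is trivial at the component `0`. -/
theorem TAlg.coact_first (ξ : k) (hdm : d * m = n) (t : Fin m → KAlg k d m n q ξ) :
    (KAlg.comodAlg (q := q) ξ hdm).coact (TAlg.first ξ hdm t) =
      (TAlg.first ξ hdm).toLinearMap.lTensor _ (TAlg.coact (q := q) ξ hdm t) := by
  refine Eq.trans ?_ (TAlg.projAt_coact hdm t ⟨0, m_pos hdm⟩).symm
  have h : Taft.conj 0 = AlgHom.id k (Taft k n q) := by
    apply AlgHom.ext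
    intro a
    simp [Taft.conj_apply]
  change _ = TAlg.coactAt ξ hdm 0 _
  rw [TAlg.coactAt, h, Algebra.TensorProduct.map_id]
  rfl

/-! ### Recovering an element of `T(d, ξ)` from a linear map. -/

section Orbit

variable {ξ : k} {hdm : d * m = n}

/-- The components `F(g ^ i r)` of the element of `T(d, ξ)` associated with `F` and `r`. -/
def TAlg.ofLin (d m : ℕ) {ξ : k} (F : Taft k n q →ₗ[k] KAlg k d m n q ξ) :
    Taft k n q →ₗ[k] (Fin m → KAlg k d m n q ξ) :=
  LinearMap.pi fun i => F ∘ₗ LinearMap.mulLeft k (Taft.g ^ (i : ℕ))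

/-- The action on `T(d, ξ)` is right translation of `F` in the coordinates `F(g ^ i s)`. At `s = 1`,
component `0`, this says that the element with components `F(g ^ i)` has `F` as its associated map,
which is the surjectivity `exists_eq`. -/
theorem TAlg.rho_ofLin (F : Taft k n q →ₗ[k] KAlg k d m n q ξ)
    (hF : ∀ (a : KAlg k d m n q ξ) (r : Taft k n q), LinearMap.mul' k _ (TensorProduct.map
      (F ∘ₗ LinearMap.mulRight k r) LinearMap.id
        ((KAlg.comodAlg (q := q) ξ hdm).coact a)) = a * F r) (r s : Taft k n q) :
    TAlg.rho ξ hdm r (TAlg.ofLin d m F s) = TAlg.ofLin d m F (r * s) := by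
  have hd := TAlg.ne_zero_left hdm
  have hh : ∀ r, F (Taft.g ^ m * r) * QAlg.h = QAlg.h * F r := by
    intro r
    refine Eq.trans ?_ (hF QAlg.h r)
    have e : (KAlg.comodAlg (q := q) ξ hdm).coact QAlg.h = (Taft.g ^ m) ⊗ₜ QAlg.h :=
      KAlg.coactHom_h hdm
    rw [e]
    rfl
  have hw : ∀ r, F (Taft.x * r) + F (Taft.g * r) * QAlg.w = QAlg.w * F r := by
    intro r
    refine Eq.trans ?_ (hF QAlg.w r)
    have e : (KAlg.comodAlg (q := q) ξ hdm).coact QAlg.w = Taft.x ⊗ₜ 1 + Taft.g ⊗ₜ QAlg.w :=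
      KAlg.coactHom_w hdm
    rw [e, map_add, map_add, TensorProduct.map_tmul, TensorProduct.map_tmul, LinearMap.mul'_apply,
      LinearMap.mul'_apply, LinearMap.id_apply, LinearMap.id_apply, mul_one]
    rfl
  -- The relation for `h` iterated: it accounts for the conjugations by powers of `h` in the action
  -- of `g`.
  have hpow : ∀ (e : ℕ) (r), F (Taft.g ^ (m * e) * r) =
      QAlg.h ^ e * F r * QAlg.hinv ^ e := by
    intro e
    induction e with
    | zero => simp
    | succ e ih =>
      intro r
      have h1 : F (Taft.g ^ m * r) = QAlg.h * F r * QAlg.hinv := by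
        rw [← hh, mul_assoc, QAlg.h_mul_hinv hd, mul_one]
      rw [mul_add, mul_one, pow_add, mul_assoc, ih, h1, pow_succ, pow_succ' QAlg.hinv]
      simp only [mul_assoc]
  have hg : ∀ s, TAlg.gOp d m n q ξ 1 (TAlg.ofLin d m F s) = TAlg.ofLin d m F (Taft.g * s) := by
    intro s
    funext i
    rw [TAlg.gOp_apply]
    -- Division with remainder `1 + i = m e + j` matches the wrap-around in the action with `hpow`.
    change _ * F (Taft.g ^ ((1 + (i : ℕ)) % m) * s) * _ = F (Taft.g ^ (i : ℕ) * (Taft.g * s))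
    rw [← hpow, ← mul_assoc, ← pow_add, add_comm (m * _), TAlg.index_eq, ← mul_assoc, ← pow_succ,
      add_comm]
  induction r using QAlg.induction generalizing s with
  | ha a => simp [Algebra.algebraMap_eq_smul_one]
  | hadd a b ha hb => simp only [map_add, LinearMap.add_apply, add_mul, ha, hb]
  | hmul a b ha hb => rw [map_mul, Module.End.mul_apply, hb, ha, mul_assoc]
  | hh => rw [TAlg.rho_g, hg]
  | hw =>
    rw [TAlg.rho_x]
    funext i
    change q ^ (i : ℕ) • (QAlg.w * F (Taft.g ^ (i : ℕ) * s) -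
      TAlg.gOp d m n q ξ 1 (TAlg.ofLin d m F s) i * QAlg.w) =
        F (Taft.g ^ (i : ℕ) * (Taft.x * s))
    rw [hg]
    change q ^ (i : ℕ) • (QAlg.w * F (Taft.g ^ (i : ℕ) * s) -
      F (Taft.g ^ (i : ℕ) * (Taft.g * s)) * QAlg.w) = _
    -- The relation for `w` at `g ^ i s` leaves `F(x g ^ i s)`, and moving `g ^ i` to the left of
    -- `x` accounts for the scalar `q ^ i`.
    rw [← mul_assoc, ← mul_assoc, ← pow_succ, pow_succ', mul_assoc, ← hw, add_sub_cancel_right,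
      Taft.g_pow_mul_x, smul_mul_assoc, map_smul, mul_assoc]

end Orbit

/-- Since `g ^ i` is grouplike, `r = g ^ i` yields `g ^ i u ⊗ t_i` from `u ⊗ t`. Multiplying by `g ^
(-i)` on the left recovers the `i`-th component of the tensor. -/
theorem TAlg.first_ext_tensor (ξ : k) (hdm : d * m = n)
    {w w' : Taft k n q ⊗[k] (Fin m → KAlg k d m n q ξ)}
    (h : ∀ r : Taft k n q, (TAlg.first ξ hdm).toLinearMap.lTensor _
        (tensRho (Algebra.lmul k _) (TAlg.rho ξ hdm) (Coalgebra.comul (R := k) r) w) =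
      (TAlg.first ξ hdm).toLinearMap.lTensor _
        (tensRho (Algebra.lmul k _) (TAlg.rho ξ hdm) (Coalgebra.comul (R := k) r) w')) :
    w = w' := by
  apply TAlg.pi_tensor_ext
  intro i
  have e : ∀ w : Taft k n q ⊗[k] (Fin m → KAlg k d m n q ξ),
      (LinearMap.mulLeft k (Taft.ginv ^ (i : ℕ))).rTensor _
        ((TAlg.first ξ hdm).toLinearMap.lTensor _ (tensRho (Algebra.lmul k _) (TAlg.rho ξ hdm)
          (Coalgebra.comul (R := k) ((Taft.g : Taft k n q) ^ (i : ℕ))) w)) =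
      (LinearMap.proj (R := k) (φ := fun _ : Fin m => KAlg k d m n q ξ) i).lTensor _ w := by
    intro w
    rw [Bialgebra.comul_pow, Taft.comul_g, Algebra.TensorProduct.tmul_pow]
    induction w with
    | zero => simp
    | add u v hu hv => simp only [map_add, hu, hv]
    | tmul u t =>
      rw [tensRho_tmul, LinearMap.lTensor_tmul, LinearMap.rTensor_tmul, LinearMap.lTensor_tmul,
        AlgHom.toLinearMap_apply, TAlg.first_g_pow]
      simp [← mul_assoc, Taft.ginv_pow_mul_g_pow]
  rw [← e, ← e, h]

/-- The data which identify `T(d, ξ)` with the end. -/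
def TAlg.endData (ξ : k) (hdm : d * m = n) :
    EndData (KAlg.comodAlg (q := q) ξ hdm) (TAlg (q := q) ξ hdm) where
  p := TAlg.first ξ hdm
  central := TAlg.first_central ξ hdm
  coact_p := TAlg.coact_first ξ hdm
  crossed := isCrossed_TAlg ξ hdm
  ext := fun t t' h => funext fun i => by
    have h' := h (Taft.g ^ (i : ℕ))
    exact (TAlg.first_g_pow ξ hdm t i).symm.trans (h'.trans (TAlg.first_g_pow ξ hdm t' i))
  ext_tensor := fun _ _ h => TAlg.first_ext_tensor ξ hdm h
  exists_eq := fun F hF => ⟨TAlg.ofLin d m F 1, fun r => by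
    refine (congrArg (TAlg.first ξ hdm) (TAlg.rho_ofLin F hF r 1)).trans ?_
    change F (Taft.g ^ 0 * (r * 1)) = F r
    rw [pow_zero, one_mul, mul_one]⟩

end Taft

end TaftAdj

end

theorem mainTheorem10 {k : Type u} [Field k] [IsAlgClosed k] {n d m : ℕ} [NeZero n] {q : k}
    [hq : Fact (IsPrimitiveRoot q n)] (hdm : d * m = n) (ξ : k) :
    Nonempty (TaftAdj.AdjointAlgebra (TaftAdj.KAlg.comodAlg (q := q) ξ hdm)) ∧
    ∀ S : TaftAdj.AdjointAlgebra (TaftAdj.KAlg.comodAlg (q := q) ξ hdm),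
      Nonempty (TaftAdj.YDAlg.Iso S.toYDAlg (TaftAdj.TAlg (q := q) ξ hdm)) := by
  -- This places the regular module, at which the end is read off, among the finite-dimensional
  -- modules.
  have : FiniteDimensional k (TaftAdj.KAlg k d m n q ξ) :=
    TaftAdj.QAlg.finiteDimensional (TaftAdj.TAlg.ne_zero_left hdm) (NeZero.ne n)
  exact ⟨⟨(TaftAdj.TAlg.endData ξ hdm).adjointAlgebra⟩,
    (TaftAdj.TAlg.endData ξ hdm).nonempty_iso⟩
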